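/- Let $\mu$ be a probability measure on $\mathbb{N}=\{1,2,\dots\}$ whose support has greatest common divisor $1$. Let $(k_z)_{z\in\mathbb{Z}}$ be independent with law $\mu$, and let $G_\mu$ be the random directed spanning graph on $\mathbb{Z}$ in which every vertex $z$ has exactly one outgoing edge, pointing to its parent $z-k_z$; the components of $G_\mu$ are those of the underlying undirected graph. The ancestral line of $z$ is the decreasing sequence $z$, parent of $z$, parent of the parent of $z$, and so on. A probability measure $\lambda$ on the functions $\mathbb{Z}\to\{-1,1\}$ (with the product $\sigma$-algebra) is called a $\mu$-Gibbs measure if for every half-infinite interval $R=\{x,x+1,\dots\}$, $x\in\mathbb{Z}$, the conditional law under $\lambda$ of the values on $R$, given the values on $R^c$, is obtained by sampling $G_\mu$ (independently of the values on $R^c$) and assigning to each element of $R$ the value of its most recent ancestor in $R^c$, i.e. of the first term of its ancestral line lying in $R^c$. A $\mu$-Gibbs measure is extremal if it is not of the form $t\lambda'+(1-t)\lambda''$ with $0<t<1$ and two distinct $\mu$-Gibbs measures $\lambda',\lambda''$. For $p\in[0,1]$, let $\lambda_p$ be the law of the function obtained by sampling $G_\mu$, giving each of its components independently the value $1$ with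 probability $p$ and $-1$ with probability $1-p$, and assigning to each vertex the value of its component. 1. If $G_\mu$ has almost surely exactly one component, then the extremal $\mu$-Gibbs measures are exactly the two unit masses at the constant functions $+1$ and $-1$. 2. If $G_\mu$ has almost surely infinitely many components, then the set of extremal $\mu$-Gibbs measures is exactly $\{\lambda_p : p\in[0,1]\}$. -/

import Mathlib

open MeasureTheory ProbabilityTheory
open scoped ENNReal NNReal

noncomputable section

/-- The positive integers `ℕ+ = {1, 2, …}` carry the discrete σ-algebra. -/
instance instMeasurableSpacePNat : MeasurableSpace ℕ+ := ⊤

instance instDiscreteMeasurableSpacePNat : DiscreteMeasurableSpace ℕ+ :=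
  ⟨fun _ => MeasurableSpace.measurableSet_top⟩

namespace AncestralGibbs

/-- The law of the independent jumps `(k_z)_{z ∈ ℤ}`, each with law `μ`. -/
def jumpLaw (μ : PMF ℕ+) : Measure (ℤ → ℕ+) :=
  Measure.infinitePi fun _ : ℤ => μ.toMeasure

instance (μ : PMF ℕ+) : IsProbabilityMeasure (jumpLaw μ) := by
  unfold jumpLaw; infer_instance

/-- The parent `z - k_z` of the vertex `z`. -/
def parent (k : ℤ → ℕ+) (z : ℤ) : ℤ := z - (k z : ℤ)

/-- A realization of `G_μ`: the spanning graph on `ℤ` whose edges join each vertex `z` to its parent.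
The orientation of the edges (from `z` to its parent) plays no role for the components. -/
def jumpGraph (k : ℤ → ℕ+) : SimpleGraph ℤ :=
  SimpleGraph.fromRel fun z w => w = parent k z

/-- The `n`-th term of the ancestral line of `z`, which starts at `z` itself. -/
def ancestor (k : ℤ → ℕ+) (z : ℤ) (n : ℕ) : ℤ := (parent k)^[n] z

lemma ancestor_le (k : ℤ → ℕ+) (z : ℤ) (n : ℕ) : ancestor k z n ≤ z - n := by
  induction n with
  | zero => simp [ancestor]
  | succ n ih =>
    have h : ancestor k z (n + 1) = ancestor k z n - (k (ancestor k z n) : ℤ) := by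
      simp only [ancestor, Function.iterate_succ_apply', parent]
    have h1 : (1 : ℤ) ≤ (k (ancestor k z n) : ℤ) := by exact_mod_cast (k (ancestor k z n)).pos
    push_cast
    omega

lemma exists_ancestor_lt (k : ℤ → ℕ+) (x z : ℤ) : ∃ n, ancestor k z n < x :=
  ⟨(z - x + 1).toNat, by have := ancestor_le k z (z - x + 1).toNat; omega⟩

/-- The most recent ancestor of `z` in the complement `{…, x - 2, x - 1}` of `{x, x + 1, …}`:
the first term of the (decreasing) ancestral line of `z` that is less than `x`. -/
def firstAncestor (x : ℤ) (k : ℤ → ℕ+) (z : ℤ) : Set.Iio x := by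
  classical
  exact ⟨ancestor k z (Nat.find (exists_ancestor_lt k x z)),
    Nat.find_spec (exists_ancestor_lt k x z)⟩

/-- Each `z ≥ x` receives the value which `η` assigns to the most recent ancestor of `z`
below `x`. -/
def inherit (x : ℤ) (η : Set.Iio x → ℤˣ) (k : ℤ → ℕ+) (z : Set.Ici x) : ℤˣ :=
  η (firstAncestor x k z)

lemma measurable_ancestor (z : ℤ) (n : ℕ) :
    Measurable fun k : ℤ → ℕ+ => ancestor k z n := by
  induction n with
  | zero => simp [ancestor]
  | succ n ih =>
    have h : (fun k : ℤ → ℕ+ => ancestor k z (n + 1)) =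
        (fun q : ℤ × (ℤ → ℕ+) => parent q.2 q.1) ∘ fun k => (ancestor k z n, k) := by
      funext k
      simp only [ancestor, Function.iterate_succ_apply', Function.comp]
    rw [h]
    refine Measurable.comp ?_ (ih.prodMk measurable_id)
    refine measurable_from_prod_countable_right fun w => ?_
    have h2 : Measurable fun j : ℕ+ => w - (j : ℤ) := Measurable.of_discrete
    exact h2.comp (measurable_pi_apply w)

lemma measurable_firstAncestor (x z : ℤ) : Measurable fun k => firstAncestor x k z := by
  classical
  refine Measurable.subtype_mk ?_
  have h := measurable_find (fun k : ℤ → ℕ+ => exists_ancestor_lt k x z) fun n =>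
    measurable_ancestor z n (measurableSet_Iio (a := x))
  have h2 : Measurable fun q : ℕ × (ℤ → ℕ+) => ancestor q.2 z q.1 :=
    measurable_from_prod_countable_right fun n => measurable_ancestor z n
  exact h2.comp (h.prodMk measurable_id)

lemma measurable_inherit (x : ℤ) :
    Measurable fun q : (Set.Iio x → ℤˣ) × (ℤ → ℕ+) => inherit x q.1 q.2 := by
  refine measurable_pi_lambda _ fun z => ?_
  have h : Measurable fun q : Set.Iio x × (Set.Iio x → ℤˣ) => q.2 q.1 :=
    measurable_from_prod_countable_right fun w => measurable_pi_apply w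
  exact h.comp (((measurable_firstAncestor x z).comp measurable_snd).prodMk measurable_fst)

/-- The conditional law on `R = {x, x + 1, …}` prescribed by `μ`, given the values `η` on the
complement of `R`: sample `G_μ` and let every element of `R` inherit the value of its most recent
ancestor outside `R`. -/
def inheritKernel (μ : PMF ℕ+) (x : ℤ) : Kernel (Set.Iio x → ℤˣ) (Set.Ici x → ℤˣ) where
  toFun η := (jumpLaw μ).map (inherit x η)
  measurable' := by
    refine Measure.measurable_of_measurable_coe _ fun s hs => ?_
    have h (η : Set.Iio x → ℤˣ) : Measurable (inherit x η) :=
      (measurable_inherit x).comp measurable_prodMk_left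
    simp only [Measure.map_apply (h _) hs]
    exact measurable_measure_prodMk_left (ν := jumpLaw μ) (measurable_inherit x hs)

instance (μ : PMF ℕ+) (x : ℤ) : IsMarkovKernel (inheritKernel μ x) :=
  ⟨fun _ => Measure.isProbabilityMeasure_map
    ((measurable_inherit x).comp measurable_prodMk_left).aemeasurable⟩

/-- A law `ν` on functions `ℤ → {-1, 1}` is a `μ`-Gibbs measure if for every half-infinite
interval `R = {x, x + 1, …}` the conditional law of the values on `R`, given the values on the
complement of `R`, is the one prescribed by `μ`. -/
structure IsGibbs (μ : PMF ℕ+) (ν : Measure (ℤ → ℤˣ)) : Prop where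
  isProbabilityMeasure : IsProbabilityMeasure ν
  hasCondDistrib : ∀ x : ℤ,
    HasCondDistrib (Set.domRestrict (Set.Ici x)) (Set.domRestrict (Set.Iio x)) (inheritKernel μ x) ν

/-- The extremal `μ`-Gibbs measures: those that are not a proper convex combination of two
distinct `μ`-Gibbs measures. -/
def extremalGibbs (μ : PMF ℕ+) : Set (Measure (ℤ → ℤˣ)) :=
  Set.extremePoints ℝ≥0 {ν | IsGibbs μ ν}

/-- The law on `{-1, 1}` with mass `p` at `1` and mass `1 - p` at `-1`. -/
def spinLaw (p : unitInterval) : Measure ℤˣ :=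
  ENNReal.ofReal p • Measure.dirac 1 + ENNReal.ofReal (1 - p) • Measure.dirac (-1)

instance (p : unitInterval) : IsProbabilityMeasure (spinLaw p) :=
  ⟨by
    simp only [spinLaw, Measure.add_apply, Measure.smul_apply, measure_univ, smul_eq_mul, mul_one]
    rw [← ENNReal.ofReal_add p.2.1 (by linarith [p.2.2])]
    simp⟩

/-- The law of the colouring of `ℤ` obtained by giving the components of a graph `G` on `ℤ`
independent values with law `spinLaw p`, and every vertex the value of its component. -/
def colourLaw (p : unitInterval) (G : SimpleGraph ℤ) : Measure (ℤ → ℤˣ) :=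
  (Measure.infinitePi fun _ : G.ConnectedComponent => spinLaw p).map
    fun ξ z => ξ (G.connectedComponentMk z)

/-- The measure `λ_p`: sample `G_μ`, then colour its components independently, with value `1` with
probability `p` and `-1` with probability `1 - p`. -/
def lambdaLaw (μ : PMF ℕ+) (p : unitInterval) : Measure (ℤ → ℤˣ) :=
  (jumpLaw μ).bind fun k => colourLaw p (jumpGraph k)

end AncestralGibbs

end

namespace AncestralGibbs

open Filter Topology

/-! A law on spin configurations is determined by the numbers `plusProb ν S`, the probability that
all spins in a finite set `S` are `1`. Being Gibbs means being invariant under pulling spins back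
along independent ancestral lines (`isGibbs_iff`), so `plusProb ν S` is the average of `plusProb ν`
over the random set of ancestors of `S` below any level. For a single vertex this makes the
one-point function bounded and harmonic for the walk with jump law `μ`. By the gcd hypothesis it is
a constant `p` (`harmonic_const`).

If there is one component, the lines started from a nonempty finite `S` eventually coalesce. Hence
`plusProb ν S = p`, and `ν` is the mixture with weights `p` and `1 - p` of the two point masses.

Suppose now that there are infinitely many components. Two lines behave like independent walks until
they meet. If two independent walks from one vertex almost surely met again, aperiodicity would make
all lines meet, so `escapeProb μ` is positive. Decomposing at the last common point bounds the sum
of squared visit probabilities by `(escapeProb μ)⁻¹`. By Cauchy–Schwarz the probability that the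
lines of `z` and `w` meet tends to `0` as `w → -∞` (`tendsto_meetProb`).

The pivot is `PastLimit μ ν p`: conditional one-point probabilities given the remote past tend to
`p` in `L¹`. Lines that do not meet are decoupled (`decoupling`), so `plusProb ν T` differs from `p
^ T.card` by at most the probability that two lines from `T` meet. Applied to the ancestors of `S`
at a low level, where further meetings are unlikely, this shows that at most one Gibbs measure has a
given past limit (`IsGibbs.eq_of_pastLimit`).

It remains to find past limits. For `λ_p`, the variance of the conditional probability is controlled
by meeting probabilities. Convex components inherit the past limit, so uniqueness makes `λ_p`
extremal. For an extremal `ν`, the conditional probabilities form a reverse martingale with some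
limit `g`. Affine functions of `g` are densities of Gibbs measures, so extremality forces the
variance to vanish in the limit (`tendsto_pastCorr_of_extremal`); hence `ν` has a past limit and
equals `λ_p`. -/

/-! ### Ancestral lines -/

/-- The most recent ancestor of `z` below level `x`, as an integer. -/
noncomputable def anc (x : ℤ) (k : ℤ → ℕ+) (z : ℤ) : ℤ := firstAncestor x k z

lemma anc_lt (x : ℤ) (k : ℤ → ℕ+) (z : ℤ) : anc x k z < x := (firstAncestor x k z).2

lemma anc_of_lt {x z : ℤ} (k : ℤ → ℕ+) (h : z < x) : anc x k z = z := by
  classical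
  have h0 : Nat.find (exists_ancestor_lt k x z) = 0 := by
    rw [Nat.find_eq_zero]; exact h
  change ancestor k z (Nat.find (exists_ancestor_lt k x z)) = z
  rw [h0]; rfl

/-- Together with `anc_of_lt` this is the recursion on which the inductions along lines rest. -/
lemma anc_of_le {x z : ℤ} (k : ℤ → ℕ+) (h : x ≤ z) : anc x k z = anc x k (z - (k z : ℤ)) := by
  classical
  have hsucc (n : ℕ) : ancestor k z (n + 1) = ancestor k (z - (k z : ℤ)) n := by
    simp only [ancestor, Function.iterate_succ_apply, parent]
  change ancestor k z (Nat.find (exists_ancestor_lt k x z)) =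
    ancestor k (z - (k z : ℤ)) (Nat.find (exists_ancestor_lt k x (z - (k z : ℤ))))
  have h1 : Nat.find (exists_ancestor_lt k x z) =
      Nat.find (exists_ancestor_lt k x (z - (k z : ℤ))) + 1 := by
    rw [Nat.find_eq_iff]
    refine ⟨?_, fun n hn => ?_⟩
    · rw [hsucc]; exact Nat.find_spec (exists_ancestor_lt k x (z - (k z : ℤ)))
    · cases n with
      | zero => simpa [ancestor] using h
      | succ n =>
        rw [hsucc]
        exact Nat.find_min (exists_ancestor_lt k x (z - (k z : ℤ))) (by omega)
  rw [h1, hsucc]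

lemma one_le_jump (k : ℤ → ℕ+) (z : ℤ) : (1 : ℤ) ≤ (k z : ℤ) := by exact_mod_cast (k z).pos

/-- Induction along ancestral lines: descend below `x`, one jump at a time. -/
lemma line_induction (x : ℤ) {P : ℤ → Prop} (below : ∀ z < x, P z)
    (step : ∀ z, x ≤ z → (∀ w < z, P w) → P z) (z : ℤ) : P z := by
  have key : ∀ n : ℕ, ∀ z : ℤ, z < x + n → P z := by
    intro n
    induction n with
    | zero => intro z hz; exact below z (by simpa using hz)
    | succ n ih =>
      intro z hz
      by_cases hx : z < x
      · exact below z hx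
      · exact step z (not_lt.mp hx) fun w hw => ih w (by push_cast at hz; omega)
  exact key (z - x + 1).toNat z (by omega)

lemma anc_congr {x z : ℤ} {k k' : ℤ → ℕ+} (h : ∀ v, x ≤ v → v ≤ z → k v = k' v) :
    anc x k z = anc x k' z := by
  induction z using line_induction x with
  | below z hz => rw [anc_of_lt k hz, anc_of_lt k' hz]
  | step z hz ih =>
    have h1 := one_le_jump k z
    rw [anc_of_le k hz, anc_of_le k' hz, ← h z hz le_rfl]
    exact ih _ (by omega) fun v hv hv' => h v hv (by omega)

lemma anc_anc {x y : ℤ} (h : y ≤ x) (k : ℤ → ℕ+) (z : ℤ) : anc y k (anc x k z) = anc y k z := by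
  induction z using line_induction x with
  | below z hz => rw [anc_of_lt k hz]
  | step z hz ih =>
    have h1 := one_le_jump k z
    rw [anc_of_le k hz, ih _ (by omega), ← anc_of_le k (h.trans hz)]

lemma anc_self (k : ℤ → ℕ+) (z : ℤ) : anc z k z = z - (k z : ℤ) := by
  have h1 := one_le_jump k z
  rw [anc_of_le k le_rfl, anc_of_lt k (by omega)]

lemma measurable_anc (x z : ℤ) : Measurable fun k => anc x k z :=
  measurable_subtype_coe.comp (measurable_firstAncestor x z)

lemma anc_shift (x t : ℤ) (k : ℤ → ℕ+) (z : ℤ) :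
    anc (x + t) (fun v => k (v - t)) (z + t) = anc x k z + t := by
  induction z using line_induction x with
  | below z hz => rw [anc_of_lt _ hz, anc_of_lt _ (by omega)]
  | step z hz ih =>
    have h1 := one_le_jump k z
    rw [anc_of_le k hz, anc_of_le _ (by omega), ← ih _ (by omega)]
    congr 1
    simp only [add_sub_cancel_right]
    ring

/-- The ancestral lines of `z` and `w` meet. -/
def Meet (k : ℤ → ℕ+) (z w : ℤ) : Prop := ∃ x, anc x k z = anc x k w

lemma anc_eq_of_le {k : ℤ → ℕ+} {x y z w : ℤ} (h : anc x k z = anc x k w) (hy : y ≤ x) :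
    anc y k z = anc y k w := by
  rw [← anc_anc hy k z, h, anc_anc hy]

lemma Meet.refl (k : ℤ → ℕ+) (z : ℤ) : Meet k z z := ⟨z, rfl⟩

lemma Meet.symm {k : ℤ → ℕ+} {z w : ℤ} (h : Meet k z w) : Meet k w z :=
  h.imp fun _ => Eq.symm

lemma meet_comm {k : ℤ → ℕ+} {z w : ℤ} : Meet k z w ↔ Meet k w z := ⟨.symm, .symm⟩

lemma Meet.trans {k : ℤ → ℕ+} {z w v : ℤ} (h : Meet k z w) (h' : Meet k w v) : Meet k z v := by
  obtain ⟨x, hx⟩ := h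
  obtain ⟨y, hy⟩ := h'
  exact ⟨min x y, (anc_eq_of_le hx (min_le_left _ _)).trans (anc_eq_of_le hy (min_le_right _ _))⟩

lemma meet_anc (x : ℤ) (k : ℤ → ℕ+) (z : ℤ) : Meet k z (anc x k z) :=
  ⟨x, (anc_anc le_rfl k z).symm⟩

lemma meet_parent (k : ℤ → ℕ+) (z : ℤ) : Meet k z (z - (k z : ℤ)) := by
  have := meet_anc z k z
  rwa [anc_self] at this

lemma meet_sub_left {k : ℤ → ℕ+} {z w : ℤ} : Meet k z w ↔ Meet k (z - (k z : ℤ)) w :=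
  ⟨(meet_parent k z).symm.trans, (meet_parent k z).trans⟩

lemma Meet.eventually {k : ℤ → ℕ+} {z w : ℤ} (h : Meet k z w) :
    ∀ᶠ x in atBot, anc x k z = anc x k w := by
  obtain ⟨x, hx⟩ := h
  filter_upwards [eventually_le_atBot x] with y hy using anc_eq_of_le hx hy

lemma Meet.congr {k k' : ℤ → ℕ+} {z w : ℤ} (h : ∀ v, v ≤ z ∨ v ≤ w → k v = k' v)
    (hm : Meet k z w) : Meet k' z w := by
  obtain ⟨x, hx⟩ := hm
  refine ⟨x, ?_⟩
  rw [← anc_congr (k := k) fun v _ hv => h v (.inl hv), hx,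
    anc_congr (k := k) fun v _ hv => h v (.inr hv)]

/-- Lines only descend, so jumps above both starting points are irrelevant. This locality is the
source of every independence used below. -/
lemma meet_congr {k k' : ℤ → ℕ+} {z w : ℤ} (h : ∀ v, v ≤ z ∨ v ≤ w → k v = k' v) :
    Meet k z w ↔ Meet k' z w :=
  ⟨.congr h, .congr fun v hv => (h v hv).symm⟩

lemma meet_shift (t : ℤ) (k : ℤ → ℕ+) (z w : ℤ) :
    Meet (fun v => k (v - t)) (z + t) (w + t) ↔ Meet k z w := by
  constructor
  · rintro ⟨x, hx⟩
    refine ⟨x - t, ?_⟩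
    have h1 := anc_shift (x - t) t k z
    have h2 := anc_shift (x - t) t k w
    rw [sub_add_cancel] at h1 h2
    omega
  · rintro ⟨x, hx⟩
    exact ⟨x + t, by rw [anc_shift, anc_shift, hx]⟩

lemma measurableSet_meet (z w : ℤ) : MeasurableSet {k | Meet k z w} := by
  simp only [Meet, Set.ofPred_exists]
  exact .iUnion fun x => measurableSet_eq_fun (measurable_anc x z) (measurable_anc x w)

lemma reachable_anc (x : ℤ) (k : ℤ → ℕ+) (z : ℤ) : (jumpGraph k).Reachable z (anc x k z) := by
  induction z using line_induction x with
  | below z hz => rw [anc_of_lt k hz]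
  | step z hz ih =>
    have h1 := one_le_jump k z
    rw [anc_of_le k hz]
    refine .trans (SimpleGraph.Adj.reachable ?_) (ih _ (by omega))
    rw [jumpGraph, SimpleGraph.fromRel_adj]
    exact ⟨by omega, .inl rfl⟩

lemma reachable_iff_meet {k : ℤ → ℕ+} {z w : ℤ} : (jumpGraph k).Reachable z w ↔ Meet k z w := by
  constructor
  · rintro ⟨p⟩
    induction p with
    | nil => exact .refl k _
    | cons h _ ih =>
      refine .trans ?_ ih
      rw [jumpGraph, SimpleGraph.fromRel_adj] at h
      rcases h.2 with rfl | rfl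
      · exact meet_parent k _
      · exact (meet_parent k _).symm
  · rintro ⟨x, hx⟩
    refine (reachable_anc x k z).trans ?_
    rw [hx]
    exact (reachable_anc x k w).symm

/-! ### The law of the jumps -/

lemma measurable_piecewise_pair (A : Set ℤ) [∀ z, Decidable (z ∈ A)] :
    Measurable fun q : (ℤ → ℕ+) × (ℤ → ℕ+) => A.piecewise q.1 q.2 := by
  refine measurable_pi_lambda _ fun z => ?_
  by_cases hz : z ∈ A <;> simp only [Set.piecewise, hz, if_true, if_false] <;> fun_prop

/-- Independence of the jumps on `A` from those off `A`, as invariance under resampling. Taking `A`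
a single vertex gives one-step conditioning, and `A` a half-line gives the Markov property at a
level. -/
lemma jumpLaw_map_piecewise (μ : PMF ℕ+) (A : Set ℤ) [∀ z, Decidable (z ∈ A)] :
    ((jumpLaw μ).prod (jumpLaw μ)).map (fun q => A.piecewise q.1 q.2) = jumpLaw μ := by
  refine Measure.eq_infinitePi _ fun s t ht => ?_
  rw [Measure.map_apply (measurable_piecewise_pair A) (.pi s.countable_toSet fun i _ => ht i)]
  have hpre : (fun q : (ℤ → ℕ+) × (ℤ → ℕ+) => A.piecewise q.1 q.2) ⁻¹' Set.pi s t =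
      Set.pi (s.filter (· ∈ A) : Finset ℤ) t ×ˢ Set.pi (s.filter (· ∉ A) : Finset ℤ) t := by
    ext q
    simp only [Set.mem_preimage, Set.mem_pi, Set.mem_prod, Finset.coe_filter, Set.mem_ofPred_eq,
      Finset.mem_coe]
    constructor
    · intro h
      refine ⟨fun i hi => ?_, fun i hi => ?_⟩
      · simpa [hi.2] using h i hi.1
      · simpa [hi.2] using h i hi.1
    · intro h i hi
      by_cases hA : i ∈ A
      · simpa [hA] using h.1 i ⟨hi, hA⟩
      · simpa [hA] using h.2 i ⟨hi, hA⟩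
  rw [hpre, Measure.prod_prod, jumpLaw, Measure.infinitePi_pi _ fun i _ => ht i,
    Measure.infinitePi_pi _ fun i _ => ht i, Finset.prod_filter_mul_prod_filter_not]

lemma jumpLaw_map_eval (μ : PMF ℕ+) (z : ℤ) :
    (jumpLaw μ).map (fun k => k z) = μ.toMeasure :=
  Measure.infinitePi_map_eval (fun _ : ℤ => μ.toMeasure) z

/-- Resampling the jump at a single vertex. -/
lemma jumpLaw_map_update (μ : PMF ℕ+) (z : ℤ) :
    (μ.toMeasure.prod (jumpLaw μ)).map (fun q => Function.update q.2 z q.1) = jumpLaw μ := by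
  classical
  have h1 : μ.toMeasure.prod (jumpLaw μ) =
      ((jumpLaw μ).prod (jumpLaw μ)).map (Prod.map (fun k => k z) id) := by
    rw [← Measure.map_prod_map _ _ (measurable_pi_apply z) measurable_id, jumpLaw_map_eval,
      Measure.map_id]
  have hm : Measurable fun q : ℕ+ × (ℤ → ℕ+) => Function.update q.2 z q.1 := by fun_prop
  rw [h1, Measure.map_map hm (by fun_prop)]
  conv_rhs => rw [← jumpLaw_map_piecewise μ {z}]
  congr 1
  funext q
  ext v
  by_cases hv : v = z
  · subst hv; simp
  · simp [hv]

lemma integral_jumpLaw_update (μ : PMF ℕ+) (z : ℤ) {f : (ℤ → ℕ+) → ℝ} (hf : Measurable f)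
    {C : ℝ} (hC : ∀ k, |f k| ≤ C) :
    ∫ k, f k ∂jumpLaw μ = ∫ j, ∫ k, f (Function.update k z j) ∂jumpLaw μ ∂μ.toMeasure := by
  have hm : Measurable fun q : ℕ+ × (ℤ → ℕ+) => Function.update q.2 z q.1 := by fun_prop
  conv_lhs => rw [← jumpLaw_map_update μ z]
  rw [integral_map hm.aemeasurable hf.aestronglyMeasurable, integral_prod]
  exact .of_bound (hf.comp hm).aestronglyMeasurable C (.of_forall fun q => hC _)

lemma jumpLaw_map_shift (μ : PMF ℕ+) (t : ℤ) :
    (jumpLaw μ).map (fun k v => k (v - t)) = jumpLaw μ := by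
  classical
  refine Measure.eq_infinitePi _ fun s A hA => ?_
  rw [Measure.map_apply (by fun_prop) (.pi s.countable_toSet fun i _ => hA i)]
  have hpre : (fun (k : ℤ → ℕ+) v => k (v - t)) ⁻¹' Set.pi s A =
      Set.pi (s.map (Equiv.subRight t).toEmbedding : Finset ℤ) fun v => A (v + t) := by
    ext k
    simp
  rw [hpre, jumpLaw, Measure.infinitePi_pi _ fun i _ => hA _, Finset.prod_map]
  simp

/-! ### Measures on spin configurations -/

lemma measurableSet_eq_one : MeasurableSet {s : ℤˣ | s = 1} := by
  have : {s : ℤˣ | s = 1} = Units.val ⁻¹' {(1 : ℤ)} := by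
    ext s; simp
  rw [this]
  exact ⟨{1}, measurableSet_singleton _, rfl⟩

/-- The event that all spins in `S` are `1`. -/
def allOne (S : Finset ℤ) : Set (ℤ → ℤˣ) := {X | ∀ z ∈ S, X z = 1}

lemma allOne_eq_pi (S : Finset ℤ) : allOne S = Set.pi S fun _ => {s : ℤˣ | s = 1} := by
  ext X; simp [allOne]

lemma measurableSet_allOne (S : Finset ℤ) : MeasurableSet (allOne S) := by
  rw [allOne_eq_pi]
  exact .pi S.countable_toSet fun _ _ => measurableSet_eq_one

@[simp]
lemma allOne_empty : allOne ∅ = Set.univ := by simp [allOne]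

lemma allOne_union (S T : Finset ℤ) : allOne (S ∪ T) = allOne S ∩ allOne T := by
  ext X; simp [allOne, or_imp, forall_and]

/-- The spin space has two points, so the single event of being `1` generates its σ-algebra. This is
why events involving only the value `1` suffice as a π-system. -/
lemma units_measurableSpace_eq :
    (Units.instMeasurableSpace : MeasurableSpace ℤˣ) = .generateFrom {{s : ℤˣ | s = 1}} := by
  classical
  apply le_antisymm
  · intro s _
    have h1 : @MeasurableSet _ (.generateFrom {{s : ℤˣ | s = 1}}) {s : ℤˣ | s = 1} :=
      .basic _ rfl
    have hc := h1.compl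
    have key : s = (if (1 : ℤˣ) ∈ s then {s : ℤˣ | s = 1} else ∅) ∪
        (if (-1 : ℤˣ) ∈ s then {s : ℤˣ | s = 1}ᶜ else ∅) := by
      ext u
      rcases Int.units_eq_one_or u with rfl | rfl <;> split_ifs <;> simp_all
    rw [key]
    refine @MeasurableSet.union _ (_) _ _ ?_ ?_ <;> split_ifs
    · exact h1
    · exact @MeasurableSet.empty _ (_)
    · exact hc
    · exact @MeasurableSet.empty _ (_)
  · refine MeasurableSpace.generateFrom_le ?_
    rintro _ rfl
    exact measurableSet_eq_one

lemma isPiSystem_allOne : IsPiSystem (Set.range allOne) := by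
  rintro _ ⟨S, rfl⟩ _ ⟨T, rfl⟩ _
  exact ⟨S ∪ T, allOne_union S T⟩

lemma generateFrom_allOne :
    (inferInstance : MeasurableSpace (ℤ → ℤˣ)) = .generateFrom (Set.range allOne) := by
  apply le_antisymm
  · refine iSup_le fun z => ?_
    change MeasurableSpace.comap _ Units.instMeasurableSpace ≤ _
    rw [units_measurableSpace_eq, MeasurableSpace.comap_generateFrom]
    refine MeasurableSpace.generateFrom_le ?_
    rintro _ ⟨_, rfl, rfl⟩
    refine .basic _ ⟨{z}, ?_⟩
    ext X; simp [allOne]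
  · refine MeasurableSpace.generateFrom_le ?_
    rintro _ ⟨S, rfl⟩
    exact measurableSet_allOne S

/-- The probability under `ν` that all spins in `S` are `1`. -/
noncomputable def plusProb (ν : Measure (ℤ → ℤˣ)) (S : Finset ℤ) : ℝ := ν.real (allOne S)

lemma plusProb_nonneg (ν : Measure (ℤ → ℤˣ)) (S : Finset ℤ) : 0 ≤ plusProb ν S :=
  measureReal_nonneg

lemma plusProb_le_one (ν : Measure (ℤ → ℤˣ)) [IsProbabilityMeasure ν] (S : Finset ℤ) :
    plusProb ν S ≤ 1 := measureReal_le_one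

lemma abs_plusProb_le (ν : Measure (ℤ → ℤˣ)) [IsProbabilityMeasure ν] (S : Finset ℤ) :
    |plusProb ν S| ≤ 1 := by
  rw [abs_of_nonneg (plusProb_nonneg ν S)]; exact plusProb_le_one ν S

lemma ext_of_plusProb {ν ν' : Measure (ℤ → ℤˣ)} [IsProbabilityMeasure ν] [IsProbabilityMeasure ν']
    (h : ∀ S, plusProb ν S = plusProb ν' S) : ν = ν' := by
  refine ext_of_generate_finite _ generateFrom_allOne isPiSystem_allOne ?_ (by simp)
  rintro _ ⟨S, rfl⟩
  exact (measureReal_eq_measureReal_iff).mp (h S)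

/-! ### Gibbs measures as laws invariant under pulling back -/

/-- The configuration in which every vertex takes the value of its most recent ancestor
below `x`. -/
noncomputable def pull (x : ℤ) (k : ℤ → ℕ+) (X : ℤ → ℤˣ) : ℤ → ℤˣ := fun z => X (anc x k z)

lemma measurable_apply_anc (x z : ℤ) :
    Measurable fun q : (ℤ → ℤˣ) × (ℤ → ℕ+) => q.1 (anc x q.2 z) := by
  have h : Measurable fun q : ℤ × (ℤ → ℤˣ) => q.2 q.1 :=
    measurable_from_prod_countable_right fun w => measurable_pi_apply w
  exact h.comp (((measurable_anc x z).comp measurable_snd).prodMk measurable_fst)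

lemma measurable_pull (x : ℤ) :
    Measurable fun q : (ℤ → ℤˣ) × (ℤ → ℕ+) => pull x q.2 q.1 :=
  measurable_pi_lambda _ fun z => measurable_apply_anc x z

lemma pull_mem_allOne {x : ℤ} {k : ℤ → ℕ+} {X : ℤ → ℤˣ} {S : Finset ℤ} :
    pull x k X ∈ allOne S ↔ X ∈ allOne (S.image (anc x k)) := by
  simp [pull, allOne]

/-- The image depends on finitely many integer-valued random variables, hence takes values through a
countable discrete space on which any `g` is measurable. -/
lemma measurable_image_anc {β : Type*} [MeasurableSpace β] (x : ℤ) (S : Finset ℤ)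
    (g : Finset ℤ → β) : Measurable fun k : ℤ → ℕ+ => g (S.image (anc x k)) := by
  have h1 : Measurable fun (k : ℤ → ℕ+) (z : S) => anc x k z :=
    measurable_pi_lambda _ fun z => measurable_anc x z
  have h2 : Measurable fun a : S → ℤ => g (Finset.univ.image a) := .of_discrete
  have h3 : (fun k : ℤ → ℕ+ => g (S.image (anc x k))) =
      (fun a : S → ℤ => g (Finset.univ.image a)) ∘ fun k z => anc x k z := by
    funext k
    simp only [Function.comp]
    congr 1
    ext v
    simp
  exact h3 ▸ h2.comp h1

lemma measurable_domRestrict_spin (A : Set ℤ) :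
    Measurable (Set.domRestrict (π := fun _ => ℤˣ) A) :=
  measurable_pi_lambda _ fun _ => measurable_pi_apply _

lemma measurable_domRestrict_inherit (x : ℤ) :
    Measurable fun q : (ℤ → ℤˣ) × (ℤ → ℕ+) =>
      (Set.domRestrict (Set.Iio x) q.1, inherit x (Set.domRestrict (Set.Iio x) q.1) q.2) := by
  have h := (measurable_domRestrict_spin (Set.Iio x)).comp
    (measurable_fst : Measurable (Prod.fst : (ℤ → ℤˣ) × (ℤ → ℕ+) → _))
  exact h.prodMk ((measurable_inherit x).comp (h.prodMk measurable_snd))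

lemma map_compProd_inheritKernel (μ : PMF ℕ+) (x : ℤ) (ν : Measure (ℤ → ℤˣ))
    [IsProbabilityMeasure ν] :
    (ν.map (Set.domRestrict (Set.Iio x))) ⊗ₘ inheritKernel μ x =
      (ν.prod (jumpLaw μ)).map fun q =>
        (Set.domRestrict (Set.Iio x) q.1, inherit x (Set.domRestrict (Set.Iio x) q.1) q.2) := by
  have hr := measurable_domRestrict_spin (Set.Iio x)
  have hm := measurable_domRestrict_inherit x
  have : IsProbabilityMeasure (ν.map (Set.domRestrict (π := fun _ => ℤˣ) (Set.Iio x))) :=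
    Measure.isProbabilityMeasure_map hr.aemeasurable
  ext s hs
  rw [Measure.compProd_apply hs, lintegral_map (Kernel.measurable_kernel_prodMk_left hs) hr,
    Measure.map_apply hm hs, Measure.prod_apply (hm hs)]
  refine lintegral_congr fun X => ?_
  change (jumpLaw μ).map (inherit x _) _ = _
  have hi : Measurable (inherit x (Set.domRestrict (Set.Iio x) X)) :=
    (measurable_inherit x).comp
      (measurable_prodMk_left (x := Set.domRestrict (Set.Iio x) X))
  rw [Measure.map_apply hi (measurable_prodMk_left hs)]
  rfl

/-- A law is Gibbs iff it is invariant under pulling back along independent ancestral lines. -/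
lemma isGibbs_iff (μ : PMF ℕ+) (ν : Measure (ℤ → ℤˣ)) [IsProbabilityMeasure ν] :
    IsGibbs μ ν ↔ ∀ x, (ν.prod (jumpLaw μ)).map (fun q => pull x q.2 q.1) = ν := by
  have hr := measurable_domRestrict_spin
  constructor
  · intro h x
    have h1 := (h.hasCondDistrib x).map_eq
    rw [map_compProd_inheritKernel] at h1
    classical
    let glue : (Set.Iio x → ℤˣ) × (Set.Ici x → ℤˣ) → ℤ → ℤˣ := fun q z =>
      if hz : z < x then q.1 ⟨z, hz⟩ else q.2 ⟨z, not_lt.mp hz⟩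
    have hglue : Measurable glue := by
      refine measurable_pi_lambda _ fun z => ?_
      by_cases hz : z < x
      · simp only [glue, hz, dif_pos]; fun_prop
      · simp only [glue, hz, dif_neg, not_false_eq_true]; fun_prop
    have h2 := congrArg (Measure.map glue) h1
    rw [Measure.map_map hglue ((hr _).prodMk (hr _)), Measure.map_map hglue
      (measurable_domRestrict_inherit x)] at h2
    have h3 : (glue ∘ fun X : ℤ → ℤˣ =>
        (Set.domRestrict (Set.Iio x) X, Set.domRestrict (Set.Ici x) X)) = id := by
      ext X z
      by_cases hz : z < x <;> simp [glue, hz]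
    rw [h3, Measure.map_id] at h2
    refine Eq.trans ?_ h2.symm
    congr 1
    funext q z
    by_cases hz : z < x
    · simp [glue, hz, pull, anc_of_lt]
    · simp [glue, hz, pull, inherit, anc]
  · intro h
    refine ⟨inferInstance, fun x => ⟨((hr _).prodMk (hr _)).aemeasurable, ?_⟩⟩
    rw [map_compProd_inheritKernel]
    conv_lhs => rw [← h x]
    rw [Measure.map_map ((hr _).prodMk (hr _)) (measurable_pull x)]
    congr 1
    funext q
    simp only [Function.comp]
    congr 1
    funext z
    exact congrArg q.1 (anc_of_lt q.2 z.2)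

lemma isGibbs_of_plusProb (μ : PMF ℕ+) (ν : Measure (ℤ → ℤˣ)) [IsProbabilityMeasure ν]
    (h : ∀ x S, plusProb ν S = ∫ k, plusProb ν (S.image (anc x k)) ∂jumpLaw μ) :
    IsGibbs μ ν := by
  rw [isGibbs_iff]
  intro x
  have : IsProbabilityMeasure ((ν.prod (jumpLaw μ)).map (fun q => pull x q.2 q.1)) :=
    Measure.isProbabilityMeasure_map (measurable_pull x).aemeasurable
  refine ext_of_plusProb fun S => ?_
  rw [h x S, plusProb, measureReal_def, Measure.map_apply (measurable_pull x)
    (measurableSet_allOne S), Measure.prod_apply_symm (measurable_pull x (measurableSet_allOne S)),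
    integral_eq_lintegral_of_nonneg_ae (.of_forall fun k => plusProb_nonneg _ _)
    (measurable_image_anc x S _).aestronglyMeasurable]
  congr 1
  refine lintegral_congr fun k => ?_
  rw [plusProb, ofReal_measureReal]
  congr 1
  ext X
  exact pull_mem_allOne

lemma IsGibbs.integral_eq {μ : PMF ℕ+} {ν : Measure (ℤ → ℤˣ)} (h : IsGibbs μ ν) (x : ℤ)
    {f : (ℤ → ℤˣ) → ℝ} (hf : Measurable f) {C : ℝ} (hC : ∀ X, |f X| ≤ C) :
    ∫ X, f X ∂ν = ∫ X, ∫ k, f (pull x k X) ∂jumpLaw μ ∂ν := by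
  have := h.isProbabilityMeasure
  conv_lhs => rw [← (isGibbs_iff μ ν).mp h x]
  rw [integral_map (measurable_pull x).aemeasurable hf.aestronglyMeasurable, integral_prod]
  exact .of_bound (hf.comp (measurable_pull x)).aestronglyMeasurable C (.of_forall fun q => hC _)

lemma IsGibbs.plusProb_eq {μ : PMF ℕ+} {ν : Measure (ℤ → ℤˣ)} (h : IsGibbs μ ν) (x : ℤ)
    (S : Finset ℤ) : plusProb ν S = ∫ k, plusProb ν (S.image (anc x k)) ∂jumpLaw μ := by
  have := h.isProbabilityMeasure
  rw [integral_eq_lintegral_of_nonneg_ae (.of_forall fun k => plusProb_nonneg _ _)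
    (measurable_image_anc x S _).aestronglyMeasurable]
  have h1 := (isGibbs_iff μ ν).mp h x
  rw [plusProb, measureReal_def]
  nth_rw 1 [← h1]
  rw [Measure.map_apply (measurable_pull x)
    (measurableSet_allOne S), Measure.prod_apply_symm (measurable_pull x (measurableSet_allOne S))]
  congr 1
  refine lintegral_congr fun k => ?_
  rw [plusProb, ofReal_measureReal]
  congr 1
  ext X
  exact pull_mem_allOne

/-! ### Conditional one-point probabilities given the past -/

/-- The indicator of the event that the spin at `z` is `1`. -/
noncomputable def ind (X : ℤ → ℤˣ) (z : ℤ) : ℝ := if X z = 1 then 1 else 0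

lemma ind_nonneg (X : ℤ → ℤˣ) (z : ℤ) : 0 ≤ ind X z := by unfold ind; split_ifs <;> simp

lemma ind_le_one (X : ℤ → ℤˣ) (z : ℤ) : ind X z ≤ 1 := by unfold ind; split_ifs <;> simp

lemma measurable_ite_one : Measurable fun s : ℤˣ => if s = 1 then (1 : ℝ) else 0 :=
  .ite measurableSet_eq_one measurable_const measurable_const

lemma measurable_ind (z : ℤ) : Measurable fun X => ind X z :=
  measurable_ite_one.comp (measurable_pi_apply z)

lemma measurable_ind_anc (x z : ℤ) :
    Measurable fun q : (ℤ → ℤˣ) × (ℤ → ℕ+) => ind q.1 (anc x q.2 z) :=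
  measurable_ite_one.comp (measurable_apply_anc x z)

lemma prod_ind (S : Finset ℤ) (X : ℤ → ℤˣ) :
    ∏ z ∈ S, ind X z = (allOne S).indicator 1 X := by
  classical
  by_cases h : X ∈ allOne S
  · rw [Set.indicator_of_mem h]
    exact Finset.prod_eq_one fun z hz => by simp [ind, h z hz]
  · rw [Set.indicator_of_notMem h]
    simp only [allOne, Set.mem_ofPred_eq, not_forall] at h
    obtain ⟨z, hz, hX⟩ := h
    exact Finset.prod_eq_zero hz (by simp [ind, hX])

lemma plusProb_eq_integral (ν : Measure (ℤ → ℤˣ)) (S : Finset ℤ) :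
    plusProb ν S = ∫ X, ∏ z ∈ S, ind X z ∂ν := by
  simp only [prod_ind]
  rw [integral_indicator_one (measurableSet_allOne S), plusProb]

/-- The conditional probability, given the spins below `y`, that the spin at `z` is `1`. -/
noncomputable def condPlus (μ : PMF ℕ+) (y z : ℤ) (X : ℤ → ℤˣ) : ℝ :=
  ∫ k, ind X (anc y k z) ∂jumpLaw μ

lemma measurable_condPlus (μ : PMF ℕ+) (y z : ℤ) : Measurable (condPlus μ y z) :=
  (measurable_ind_anc y z).stronglyMeasurable.integral_prod_right'.measurable

lemma condPlus_nonneg (μ : PMF ℕ+) (y z : ℤ) (X : ℤ → ℤˣ) : 0 ≤ condPlus μ y z X :=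
  integral_nonneg fun _ => ind_nonneg _ _

lemma condPlus_le_one (μ : PMF ℕ+) (y z : ℤ) (X : ℤ → ℤˣ) : condPlus μ y z X ≤ 1 := by
  refine (integral_mono_of_nonneg (.of_forall fun _ => ind_nonneg _ _) (integrable_const 1)
    (.of_forall fun _ => ind_le_one _ _)).trans ?_
  simp

lemma abs_condPlus_le (μ : PMF ℕ+) (y z : ℤ) (X : ℤ → ℤˣ) : |condPlus μ y z X| ≤ 1 := by
  rw [abs_of_nonneg (condPlus_nonneg ..)]; exact condPlus_le_one ..

lemma integral_mul_condPlus (μ : PMF ℕ+) (ν : Measure (ℤ → ℤˣ)) [IsProbabilityMeasure ν]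
    (y z : ℤ) {f : (ℤ → ℤˣ) → ℝ} (hf : Measurable f) {C : ℝ} (hC : ∀ X, |f X| ≤ C) :
    ∫ X, f X * condPlus μ y z X ∂ν = ∫ k, ∫ X, f X * ind X (anc y k z) ∂ν ∂jumpLaw μ := by
  simp only [condPlus, ← integral_const_mul]
  refine integral_integral_swap ?_
  refine .of_bound ((hf.comp measurable_fst).mul (measurable_ind_anc y z)).aestronglyMeasurable C
    (.of_forall fun q => ?_)
  simp only [Function.uncurry, norm_mul, Real.norm_eq_abs]
  rw [abs_of_nonneg (ind_nonneg _ _)]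
  exact (mul_le_of_le_one_right (abs_nonneg _) (ind_le_one _ _)).trans (hC _)

lemma integral_prod_ind_mul_ind (ν : Measure (ℤ → ℤˣ)) (S : Finset ℤ) (v : ℤ) :
    ∫ X, (∏ z ∈ S, ind X z) * ind X v ∂ν = plusProb ν (insert v S) := by
  rw [plusProb_eq_integral]
  refine integral_congr_ae (.of_forall fun X => ?_)
  by_cases hv : v ∈ S
  · simp only [Finset.insert_eq_of_mem hv]
    rw [← Finset.mul_prod_erase S _ hv]
    have : ind X v * ind X v = ind X v := by unfold ind; split_ifs <;> simp
    linear_combination (∏ z ∈ S.erase v, ind X z) * this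
  · simp only [Finset.prod_insert hv, mul_comm]

lemma measurable_prod_ind (S : Finset ℤ) : Measurable fun X => ∏ z ∈ S, ind X z :=
  Finset.measurable_prod _ fun z _ => measurable_ind z

lemma abs_prod_ind_le (S : Finset ℤ) (X : ℤ → ℤˣ) : |∏ z ∈ S, ind X z| ≤ 1 := by
  rw [abs_of_nonneg (Finset.prod_nonneg fun z _ => ind_nonneg X z)]
  exact Finset.prod_le_one (fun z _ => ind_nonneg X z) fun z _ => ind_le_one X z

lemma integral_prod_ind_mul_condPlus (μ : PMF ℕ+) (ν : Measure (ℤ → ℤˣ)) [IsProbabilityMeasure ν]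
    (y z : ℤ) (S : Finset ℤ) :
    ∫ X, (∏ w ∈ S, ind X w) * condPlus μ y z X ∂ν =
      ∫ k, plusProb ν (insert (anc y k z) S) ∂jumpLaw μ := by
  rw [integral_mul_condPlus μ ν y z (measurable_prod_ind S) (abs_prod_ind_le S)]
  simp only [integral_prod_ind_mul_ind]

lemma integral_condPlus_mul_condPlus (μ : PMF ℕ+) (ν : Measure (ℤ → ℤˣ)) [IsProbabilityMeasure ν]
    (x y z w : ℤ) :
    ∫ X, condPlus μ x z X * condPlus μ y w X ∂ν =
      ∫ k, ∫ k', plusProb ν {anc x k' z, anc y k w} ∂jumpLaw μ ∂jumpLaw μ := by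
  rw [integral_mul_condPlus μ ν y w (measurable_condPlus μ x z) (abs_condPlus_le μ x z)]
  refine integral_congr_ae (.of_forall fun k => ?_)
  have h := integral_prod_ind_mul_condPlus μ ν x z {anc y k w}
  simp only [Finset.prod_singleton] at h
  simp only [mul_comm (condPlus μ x z _)]
  exact h

lemma IsGibbs.integral_condPlus {μ : PMF ℕ+} {ν : Measure (ℤ → ℤˣ)} (h : IsGibbs μ ν) (y z : ℤ) :
    ∫ X, condPlus μ y z X ∂ν = plusProb ν {z} := by
  have := h.isProbabilityMeasure
  have h1 := integral_prod_ind_mul_condPlus μ ν y z ∅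
  simp only [Finset.prod_empty, one_mul] at h1
  rw [h1, h.plusProb_eq y {z}]
  simp

/-- Pairing with an observable that is measurable below level `y ≤ x`. -/
lemma IsGibbs.integral_condPlus_mul_condPlus_of_le {μ : PMF ℕ+} {ν : Measure (ℤ → ℤˣ)}
    (h : IsGibbs μ ν) {x y : ℤ} (hy : y ≤ x) (z : ℤ) :
    ∫ X, condPlus μ x z X * condPlus μ y z X ∂ν =
      ∫ k, plusProb ν {z, anc y k z} ∂jumpLaw μ := by
  have := h.isProbabilityMeasure
  rw [integral_condPlus_mul_condPlus]
  refine integral_congr_ae (.of_forall fun k => ?_)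
  simp only
  -- The Gibbs property at level `x` moves `z` to its ancestor below `x` but fixes `anc y k z`,
  -- which already lies below `y ≤ x`. The result does not depend on `x`, which is the reverse
  -- martingale property in second-moment form.
  rw [h.plusProb_eq x {z, anc y k z}]
  refine integral_congr_ae (.of_forall fun k' => ?_)
  simp only [Finset.image_insert, Finset.image_singleton]
  rw [anc_of_lt k' ((anc_lt y k z).trans_le hy)]

/-! ### Bounded harmonic functions -/

lemma mul_le_lintegral (μ : PMF ℕ+) (f : ℕ+ → ℝ≥0∞) (i : ℕ+) :
    μ i * f i ≤ ∫⁻ j, f j ∂μ.toMeasure := by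
  calc μ i * f i = ∫⁻ j in {i}, f j ∂μ.toMeasure := by
        rw [lintegral_singleton, PMF.toMeasure_apply_singleton _ _ (measurableSet_singleton i),
          mul_comm]
    _ ≤ _ := setLIntegral_le_lintegral _ _

lemma mul_le_integral (μ : PMF ℕ+) {f : ℕ+ → ℝ} (h0 : ∀ j, 0 ≤ f j) {C : ℝ} (hC : ∀ j, f j ≤ C)
    (i : ℕ+) : (μ i).toReal * f i ≤ ∫ j, f j ∂μ.toMeasure := by
  have hint : Integrable f μ.toMeasure :=
    .of_bound (Measurable.of_discrete).aestronglyMeasurable C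
      (.of_forall fun j => by rw [Real.norm_of_nonneg (h0 j)]; exact hC j)
  have h := mul_le_lintegral μ (fun j => ENNReal.ofReal (f j)) i
  rw [← ofReal_integral_eq_lintegral_ofReal hint (.of_forall h0)] at h
  have h2 := ENNReal.toReal_mono ENNReal.ofReal_ne_top h
  rwa [ENNReal.toReal_mul, ENNReal.toReal_ofReal (h0 i),
    ENNReal.toReal_ofReal (integral_nonneg h0)] at h2

/-- A numerical semigroup of gcd `1` contains all large integers, so every `m` is a difference of
two of its elements. -/
lemma exists_closure_pair {s : Set ℕ} (h : Nat.setGcd s = 1) (m : ℕ) :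
    ∃ a, a ∈ AddSubmonoid.closure s ∧ a + m ∈ AddSubmonoid.closure s := by
  obtain ⟨n, hn⟩ := Nat.exists_mem_closure_of_ge s
  exact ⟨n, hn n le_rfl (by simp [h]), hn _ (by omega) (by simp [h])⟩

/-- A Choquet–Deny argument. The increment `g z = f z - f (z - d)` is again harmonic. If its
supremum were positive, near-maximality at one point would propagate along many steps of size `d`,
and the increments would add up to more than the bounded `f` allows. -/
lemma harmonic_le (μ : PMF ℕ+) {f : ℤ → ℝ} {C : ℝ} (hC : ∀ z, |f z| ≤ C)
    (hf : ∀ z, f z = ∫ j : ℕ+, f (z - (j : ℤ)) ∂μ.toMeasure) {d : ℕ+} (hd : d ∈ μ.support) (z : ℤ) :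
    f z ≤ f (z - (d : ℤ)) := by
  by_contra! hlt
  set a : ℝ := (μ d).toReal with ha
  have ha0 : 0 < a := ENNReal.toReal_pos ((PMF.mem_support_iff _ _).mp hd) (μ.apply_ne_top d)
  have ha1 : a ≤ 1 := ENNReal.toReal_mono ENNReal.one_ne_top (μ.coe_le_one d)
  have hint (z : ℤ) : Integrable (fun j : ℕ+ => f (z - (j : ℤ))) μ.toMeasure :=
    .of_bound (Measurable.of_discrete).aestronglyMeasurable C (.of_forall fun j => hC _)
  set g : ℤ → ℝ := fun z => f z - f (z - (d : ℤ)) with hg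
  have hgC (z : ℤ) : g z ≤ 2 * C := by
    have h1 := abs_le.mp (hC z)
    have h2 := abs_le.mp (hC (z - (d : ℤ)))
    simp only [hg]; linarith
  have hgC' (z : ℤ) : -(2 * C) ≤ g z := by
    have h1 := abs_le.mp (hC z)
    have h2 := abs_le.mp (hC (z - (d : ℤ)))
    simp only [hg]; linarith
  have hgint (z : ℤ) : Integrable (fun j : ℕ+ => g (z - (j : ℤ))) μ.toMeasure := by
    refine (hint z).sub ?_
    convert hint (z - (d : ℤ)) using 3
    ring
  have hgh (z : ℤ) : g z = ∫ j : ℕ+, g (z - (j : ℤ)) ∂μ.toMeasure := by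
    have h2 : (fun j : ℕ+ => g (z - (j : ℤ))) =
        fun j : ℕ+ => f (z - (j : ℤ)) - f (z - (d : ℤ) - (j : ℤ)) := by
      funext j
      simp only [hg]
      congr 2
      ring
    rw [h2, integral_sub (hint z) (hint _), ← hf, ← hf]
  have hbdd : BddAbove (Set.range g) := ⟨2 * C, by rintro _ ⟨z, rfl⟩; exact hgC z⟩
  set s := ⨆ z, g z with hs
  have hle (z : ℤ) : g z ≤ s := le_ciSup hbdd z
  have hs0 : 0 < s := lt_of_lt_of_le (by simp only [hg]; linarith) (hle z)
  -- The deficit `s - g` is nonnegative and harmonic, and the jump `d` has mass `a`; so one step of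
  -- size `d` multiplies the deficit by at most `a⁻¹`.
  have hstep (z : ℤ) : a * (s - g (z - (d : ℤ))) ≤ s - g z := by
    have h1 := mul_le_integral μ (f := fun j : ℕ+ => s - g (z - (j : ℤ)))
      (fun j => sub_nonneg.mpr (hle _)) (C := s + 2 * C) (fun j => by linarith [hgC' (z - (j : ℤ))]) d
    rwa [integral_sub (integrable_const _) (hgint z), ← hgh, integral_const, probReal_univ,
      one_smul] at h1
  -- With this `n`, `n` increments of size `s / 2` exceed `2 * C`, the largest possible oscillation
  -- of `f`. The tolerance `a ^ n * (s / 2)` at `y` keeps the deficit below `s / 2` during those `n`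
  -- steps.
  obtain ⟨n, hn⟩ := exists_nat_gt (4 * C / s)
  rw [div_lt_iff₀ hs0] at hn
  obtain ⟨y, hy⟩ : ∃ y, s - a ^ n * (s / 2) < g y :=
    exists_lt_of_lt_ciSup (by rw [← hs]; have := pow_pos ha0 n; nlinarith)
  have hdef (i : ℕ) : a ^ i * (s - g (y - i * (d : ℤ))) ≤ s - g y := by
    induction i with
    | zero => simp
    | succ i ih =>
      refine le_trans ?_ ih
      have h1 := hstep (y - i * (d : ℤ))
      have h2 : y - ((i + 1 : ℕ) : ℤ) * (d : ℤ) = y - i * (d : ℤ) - (d : ℤ) := by push_cast; ring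
      rw [h2, pow_succ, mul_assoc]
      exact mul_le_mul_of_nonneg_left h1 (pow_pos ha0 i).le
  have hhalf (i : ℕ) (hi : i < n) : s / 2 ≤ g (y - i * (d : ℤ)) := by
    have h1 := hdef i
    have h2 : a ^ n ≤ a ^ i := pow_le_pow_of_le_one ha0.le ha1 hi.le
    have h3 := pow_pos ha0 i
    by_contra! h4
    have h5 : a ^ i * (s / 2) ≤ a ^ i * (s - g (y - i * (d : ℤ))) :=
      mul_le_mul_of_nonneg_left (by linarith) h3.le
    have h6 : a ^ n * (s / 2) ≤ a ^ i * (s / 2) :=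
      mul_le_mul_of_nonneg_right h2 (by linarith)
    linarith
  have htel (m : ℕ) (hm : m ≤ n) : m * (s / 2) ≤ f y - f (y - m * (d : ℤ)) := by
    induction m with
    | zero => simp
    | succ m ih =>
      have h1 := hhalf m (by omega)
      have h2 := ih (by omega)
      have h3 : y - ((m + 1 : ℕ) : ℤ) * (d : ℤ) = y - m * (d : ℤ) - (d : ℤ) := by push_cast; ring
      simp only [hg] at h1
      rw [h3]
      push_cast
      linarith
  have h1 := htel n le_rfl
  have h2 := abs_le.mp (hC y)
  have h3 := abs_le.mp (hC (y - n * (d : ℤ)))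
  linarith

/-- Bounded harmonic functions of an aperiodic walk on `ℤ` are constant. -/
lemma harmonic_const (μ : PMF ℕ+)
    (hgcd : Nat.setGcd ((fun n : ℕ+ => (n : ℕ)) '' μ.support) = 1) {f : ℤ → ℝ} {C : ℝ}
    (hC : ∀ z, |f z| ≤ C) (hf : ∀ z, f z = ∫ j : ℕ+, f (z - (j : ℤ)) ∂μ.toMeasure) (z w : ℤ) :
    f z = f w := by
  have h1 (a : ℕ) (ha : a ∈ AddSubmonoid.closure ((fun n : ℕ+ => (n : ℕ)) '' μ.support)) :
      ∀ z : ℤ, f (z - a) = f z := by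
    induction ha using AddSubmonoid.closure_induction with
    | mem a ha =>
      obtain ⟨d, hd, rfl⟩ := ha
      intro z
      refine le_antisymm ?_ (harmonic_le μ hC hf hd z)
      have h := harmonic_le μ (f := fun z => -f z) (C := C) (fun z => by simpa using hC z)
        (fun z => by rw [integral_neg, ← hf]) hd z
      simp only [neg_le_neg_iff] at h
      exact h
    | zero => simp
    | add a b _ _ iha ihb =>
      intro z
      rw [Nat.cast_add, ← sub_sub, ihb, iha]
  have h2 (z : ℤ) (m : ℕ) : f (z - m) = f z := by
    obtain ⟨a, ha, hb⟩ := exists_closure_pair hgcd m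
    have h3 := h1 _ hb z
    rw [Nat.cast_add, add_comm, ← sub_sub, h1 a ha] at h3
    exact h3
  rcases le_total z w with h | h
  · have h3 := h2 w (w - z).toNat
    rw [Int.toNat_of_nonneg (by omega)] at h3
    rw [← h3]; congr 1; ring
  · have h3 := h2 z (z - w).toNat
    rw [Int.toNat_of_nonneg (by omega)] at h3
    rw [← h3]; congr 1; ring

/-! ### Meeting probabilities -/

lemma jumpLaw_apply_update (μ : PMF ℕ+) (z : ℤ) {E : Set (ℤ → ℕ+)} (hE : MeasurableSet E) :
    jumpLaw μ E = ∫⁻ j, jumpLaw μ {k | Function.update k z j ∈ E} ∂μ.toMeasure := by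
  have hm : Measurable fun q : ℕ+ × (ℤ → ℕ+) => Function.update q.2 z q.1 := by fun_prop
  conv_lhs => rw [← jumpLaw_map_update μ z]
  rw [Measure.map_apply hm hE, Measure.prod_apply (hm hE)]
  rfl

/-- Induction on pairs of vertices, by following the higher of the two ancestral lines. -/
lemma pair_induction (x : ℤ) {P : ℤ → ℤ → Prop} (symm : ∀ z w, P z w → P w z)
    (below : ∀ z w, z < x → w < x → P z w)
    (diag : ∀ z, x ≤ z → (∀ a < z, ∀ b < z, P a b) → P z z)
    (step : ∀ z w, x ≤ z → w < z → (∀ a < z, P a w) → P z w) (z w : ℤ) : P z w := by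
  have key : ∀ n : ℕ, ∀ z w : ℤ, z < x + n → w < x + n → P z w := by
    intro n
    induction n with
    | zero => intro z w hz hw; exact below z w (by simpa using hz) (by simpa using hw)
    | succ n ih =>
      have hstep (w : ℤ) (hw : w < x + n) : P (x + n) w :=
        step _ w (by omega) hw fun a ha => ih a w ha hw
      intro z w hz hw
      push_cast at hz hw
      rcases lt_or_eq_of_le (show z ≤ x + n by omega) with hz | rfl
      · rcases lt_or_eq_of_le (show w ≤ x + n by omega) with hw | rfl
        · exact ih z w hz hw
        · exact symm _ _ (hstep z hz)
      · rcases lt_or_eq_of_le (show w ≤ x + n by omega) with hw | rfl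
        · exact hstep w hw
        · exact diag _ (by omega) fun a ha b hb => ih a b ha hb
  exact key (max (z - x + 1) (w - x + 1)).toNat z w (by omega) (by omega)

/-- The probability that the ancestral lines of `z` and `w` do not meet. -/
noncomputable def avoidProb (μ : PMF ℕ+) (z w : ℤ) : ℝ≥0∞ := jumpLaw μ {k | ¬ Meet k z w}

/-- The probability that the ancestral lines of `z` and `w` meet. -/
noncomputable def meetProb (μ : PMF ℕ+) (z w : ℤ) : ℝ≥0∞ := jumpLaw μ {k | Meet k z w}

lemma meetProb_comm (μ : PMF ℕ+) (z w : ℤ) : meetProb μ z w = meetProb μ w z := by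
  simp only [meetProb, meet_comm]

lemma avoidProb_comm (μ : PMF ℕ+) (z w : ℤ) : avoidProb μ z w = avoidProb μ w z := by
  simp only [avoidProb, meet_comm]

@[simp]
lemma meetProb_self (μ : PMF ℕ+) (z : ℤ) : meetProb μ z z = 1 := by
  simp [meetProb, Meet.refl]

lemma avoidProb_add_meetProb (μ : PMF ℕ+) (z w : ℤ) : avoidProb μ z w + meetProb μ z w = 1 := by
  rw [add_comm]
  exact prob_add_prob_compl (measurableSet_meet z w)

/-- The line of `w < z` never uses the jump at `z`. Conditioning on that jump therefore moves only
the higher line, which gives the one-step recursions for meeting and avoidance. -/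
lemma meet_update {k : ℤ → ℕ+} {z w : ℤ} (h : w < z) (j : ℕ+) :
    Meet (Function.update k z j) z w ↔ Meet k (z - (j : ℤ)) w := by
  have hj : (1 : ℤ) ≤ (j : ℤ) := by exact_mod_cast j.pos
  rw [meet_sub_left, Function.update_self]
  refine meet_congr fun v hv => ?_
  rw [Function.update_of_ne (by omega)]

lemma meetProb_step (μ : PMF ℕ+) {z w : ℤ} (h : w < z) :
    meetProb μ z w = ∫⁻ j : ℕ+, meetProb μ (z - (j : ℤ)) w ∂μ.toMeasure := by
  rw [meetProb, jumpLaw_apply_update μ z (measurableSet_meet z w)]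
  simp only [Set.mem_ofPred_eq, meet_update h]
  rfl

lemma avoidProb_step (μ : PMF ℕ+) {z w : ℤ} (h : w < z) :
    avoidProb μ z w = ∫⁻ j : ℕ+, avoidProb μ (z - (j : ℤ)) w ∂μ.toMeasure := by
  have hE : MeasurableSet {k | ¬ Meet k z w} := (measurableSet_meet z w).compl
  rw [avoidProb, jumpLaw_apply_update μ z hE]
  simp only [Set.mem_ofPred_eq, meet_update h]
  rfl

lemma meetProb_add (μ : PMF ℕ+) (t z w : ℤ) : meetProb μ (z + t) (w + t) = meetProb μ z w := by
  rw [meetProb, ← jumpLaw_map_shift μ t, Measure.map_apply (by fun_prop) (measurableSet_meet _ _)]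
  simp only [Set.preimage_ofPred_eq, meet_shift]
  rfl

/-- The probability that two independent ancestral lines from the same vertex never meet again. -/
noncomputable def escapeProb (μ : PMF ℕ+) : ℝ≥0∞ :=
  ∫⁻ i : ℕ+, ∫⁻ j : ℕ+, avoidProb μ (-(i : ℤ)) (-(j : ℤ)) ∂μ.toMeasure ∂μ.toMeasure

lemma escapeProb_add (μ : PMF ℕ+) (z : ℤ) :
    escapeProb μ + ∫⁻ i : ℕ+, ∫⁻ j : ℕ+, meetProb μ (z - (i : ℤ)) (z - (j : ℤ)) ∂μ.toMeasure
      ∂μ.toMeasure = 1 := by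
  have h (i j : ℕ+) : meetProb μ (z - (i : ℤ)) (z - (j : ℤ)) = meetProb μ (-(i : ℤ)) (-(j : ℤ)) := by
    rw [← meetProb_add μ z (-(i : ℤ))]
    congr 1 <;> ring
  simp only [h]
  rw [escapeProb, ← lintegral_add_left .of_discrete]
  simp only [← lintegral_add_left (Measurable.of_discrete (α := ℕ+) (β := ℝ≥0∞)),
    avoidProb_add_meetProb]
  simp

/-! ### Meeting probabilities compared with common visits of independent walks -/

/-- The probability that the ancestral line of `n` visits `0`. -/
noncomputable def visitProb (μ : PMF ℕ+) (n : ℤ) : ℝ≥0∞ := jumpLaw μ {k | anc 1 k n = 0}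

lemma visitProb_zero (μ : PMF ℕ+) : visitProb μ 0 = 1 := by
  simp [visitProb, anc_of_lt]

lemma visitProb_of_neg (μ : PMF ℕ+) {n : ℤ} (h : n < 0) : visitProb μ n = 0 := by
  have (k : ℤ → ℕ+) : ¬ anc 1 k n = 0 := by rw [anc_of_lt k (by omega)]; omega
  simp [visitProb, this]

lemma anc_update {k : ℤ → ℕ+} {x z : ℤ} (h : x ≤ z) (j : ℕ+) :
    anc x (Function.update k z j) z = anc x k (z - (j : ℤ)) := by
  have hj : (1 : ℤ) ≤ (j : ℤ) := by exact_mod_cast j.pos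
  rw [anc_of_le _ h, Function.update_self]
  refine anc_congr fun v _ hv => ?_
  rw [Function.update_of_ne (by omega)]

lemma anc_update_of_lt {k : ℤ → ℕ+} {x z w : ℤ} (h : w < z) (j : ℕ+) :
    anc x (Function.update k z j) w = anc x k w :=
  anc_congr fun v _ hv => by rw [Function.update_of_ne (by omega)]

lemma visitProb_step (μ : PMF ℕ+) {n : ℤ} (h : 0 < n) :
    visitProb μ n = ∫⁻ j : ℕ+, visitProb μ (n - (j : ℤ)) ∂μ.toMeasure := by
  rw [visitProb, jumpLaw_apply_update μ n (measurableSet_eq_fun (measurable_anc 1 n)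
    measurable_const)]
  simp only [Set.mem_ofPred_eq, anc_update (show (1 : ℤ) ≤ n by omega)]
  rfl

lemma visitProb_mul_step (μ : PMF ℕ+) {z w : ℤ} (h : w < z) (v : ℤ) :
    visitProb μ (z - v) * visitProb μ (w - v) =
      ∫⁻ j : ℕ+, visitProb μ (z - (j : ℤ) - v) * visitProb μ (w - v) ∂μ.toMeasure := by
  rcases lt_or_ge v z with hv | hv
  · rw [lintegral_mul_const _ .of_discrete, visitProb_step μ (show 0 < z - v by omega)]
    simp only [sub_right_comm]
  · simp [visitProb_of_neg μ (show w - v < 0 by omega)]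

lemma visitProb_mul_self_le (μ : PMF ℕ+) (z v : ℤ) :
    visitProb μ (z - v) * visitProb μ (z - v) ≤ (if v = z then 1 else 0) +
      ∫⁻ i : ℕ+, ∫⁻ j : ℕ+, visitProb μ (z - (i : ℤ) - v) * visitProb μ (z - (j : ℤ) - v)
        ∂μ.toMeasure ∂μ.toMeasure := by
  rcases lt_trichotomy v z with hv | rfl | hv
  · have h : ∫⁻ i : ℕ+, visitProb μ (z - (i : ℤ) - v) ∂μ.toMeasure = visitProb μ (z - v) := by
      rw [visitProb_step μ (show 0 < z - v by omega)]
      simp only [sub_right_comm]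
    simp only [lintegral_const_mul _ (Measurable.of_discrete (α := ℕ+) (β := ℝ≥0∞)), h,
      lintegral_mul_const _ (Measurable.of_discrete (α := ℕ+) (β := ℝ≥0∞))]
    exact le_add_self
  · simp [visitProb_zero]
  · simp [visitProb_of_neg μ (show z - v < 0 by omega)]

/-- For independent walks from `z` and `w`, the summand at `v` times `escapeProb μ` is the
probability that `v` is their last common point, and these events are disjoint. The proof replaces
the path decomposition by comparing one-step recursions: off the diagonal they agree, and on it
`escapeProb_add` supplies the missing mass. -/
lemma escapeProb_mul_sum_le (μ : PMF ℕ+) (V : Finset ℤ) (z w : ℤ) :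
    escapeProb μ * ∑ v ∈ V, visitProb μ (z - v) * visitProb μ (w - v) ≤ meetProb μ z w := by
  -- Finiteness of `V` provides a floor for the induction: starting points below `V` visit none of
  -- it.
  obtain ⟨x, hx⟩ := V.finite_toSet.bddBelow
  induction z, w using pair_induction x with
  | symm z w h => rw [meetProb_comm]; simpa only [mul_comm (visitProb μ (w - _))] using h
  | below z w hz hw =>
    rw [Finset.sum_eq_zero fun v hv => ?_]
    · simp
    · have := hx hv
      rw [visitProb_of_neg μ (show z - v < 0 by omega), zero_mul]
  | diag z hz ih =>
    rw [meetProb_self, ← escapeProb_add μ z]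
    calc escapeProb μ * ∑ v ∈ V, visitProb μ (z - v) * visitProb μ (z - v)
        ≤ escapeProb μ * ∑ v ∈ V, ((if v = z then 1 else 0) +
          ∫⁻ i : ℕ+, ∫⁻ j : ℕ+, visitProb μ (z - (i : ℤ) - v) * visitProb μ (z - (j : ℤ) - v)
            ∂μ.toMeasure ∂μ.toMeasure) := by
          gcongr with v hv
          exact visitProb_mul_self_le μ z v
      _ = escapeProb μ * (if z ∈ V then 1 else 0) + ∫⁻ i : ℕ+, ∫⁻ j : ℕ+, escapeProb μ *
          ∑ v ∈ V, visitProb μ (z - (i : ℤ) - v) * visitProb μ (z - (j : ℤ) - v)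
            ∂μ.toMeasure ∂μ.toMeasure := by
          simp only [lintegral_const_mul _ (Measurable.of_discrete (α := ℕ+) (β := ℝ≥0∞)),
            lintegral_finsetSum _ fun _ _ => (Measurable.of_discrete (α := ℕ+) (β := ℝ≥0∞))]
          rw [Finset.sum_add_distrib, mul_add, Finset.sum_ite_eq']
      _ ≤ escapeProb μ * 1 + ∫⁻ i : ℕ+, ∫⁻ j : ℕ+, meetProb μ (z - (i : ℤ)) (z - (j : ℤ))
            ∂μ.toMeasure ∂μ.toMeasure := by
          gcongr with i j
          · split_ifs <;> simp
          · have hi : (1 : ℤ) ≤ (i : ℤ) := by exact_mod_cast i.pos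
            have hj : (1 : ℤ) ≤ (j : ℤ) := by exact_mod_cast j.pos
            exact ih _ (by omega) _ (by omega)
      _ = _ := by rw [mul_one]
  | step z w hz hw ih =>
    rw [meetProb_step μ hw]
    simp only [visitProb_mul_step μ hw]
    rw [← lintegral_finsetSum _ fun _ _ => .of_discrete, ← lintegral_const_mul _ .of_discrete]
    refine lintegral_mono fun j => ?_
    have hj : (1 : ℤ) ≤ (j : ℤ) := by exact_mod_cast j.pos
    exact ih _ (by omega)

lemma measurableSet_anc_eq (x z w : ℤ) : MeasurableSet {k | anc x k z = anc x k w} :=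
  measurableSet_eq_fun (measurable_anc x z) (measurable_anc x w)

lemma one_le_tsum_visitProb (μ : PMF ℕ+) (z : ℤ) :
    1 ≤ ∑' v, visitProb μ (z - v) * visitProb μ (z - v) := by
  have := ENNReal.le_tsum (f := fun v => visitProb μ (z - v) * visitProb μ (z - v)) z
  simpa [visitProb_zero] using this

/-- A union bound over a common point of two independent walks, again proved by recursion. Letting
`x → -∞` gives the bound for meeting at all. -/
lemma anc_eq_prob_le (μ : PMF ℕ+) (x z w : ℤ) :
    jumpLaw μ {k | anc x k z = anc x k w} ≤ ∑' v, visitProb μ (z - v) * visitProb μ (w - v) := by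
  induction z, w using pair_induction x with
  | symm z w h => simpa only [mul_comm (visitProb μ (w - _)), eq_comm (a := anc x _ w)] using h
  | below z w hz hw =>
    simp only [anc_of_lt _ hz, anc_of_lt _ hw]
    by_cases h : z = w
    · subst h
      exact prob_le_one.trans (one_le_tsum_visitProb μ z)
    · simp [h]
  | diag z hz ih => exact prob_le_one.trans (one_le_tsum_visitProb μ z)
  | step z w hz hw ih =>
    simp only [visitProb_mul_step μ hw]
    rw [← lintegral_tsum fun _ => Measurable.of_discrete.aemeasurable,
      jumpLaw_apply_update μ z (measurableSet_anc_eq x z w)]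
    refine lintegral_mono fun j => ?_
    have hj : (1 : ℤ) ≤ (j : ℤ) := by exact_mod_cast j.pos
    simp only [Set.mem_ofPred_eq, anc_update hz, anc_update_of_lt hw]
    exact ih _ (by omega)

lemma meetProb_le_tsum (μ : PMF ℕ+) (z w : ℤ) :
    meetProb μ z w ≤ ∑' v, visitProb μ (z - v) * visitProb μ (w - v) := by
  have h : {k | Meet k z w} = ⋃ n : ℕ, {k : ℤ → ℕ+ | anc (-n) k z = anc (-n) k w} := by
    ext k
    simp only [Set.mem_ofPred_eq, Set.mem_iUnion]
    constructor
    · rintro ⟨x, hx⟩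
      exact ⟨x.natAbs, anc_eq_of_le hx (by omega)⟩
    · rintro ⟨n, hn⟩
      exact ⟨_, hn⟩
  have hmono : Monotone fun n : ℕ => {k : ℤ → ℕ+ | anc (-n) k z = anc (-n) k w} :=
    fun m n hmn k hk => anc_eq_of_le hk (by omega)
  rw [meetProb, h, hmono.measure_iUnion]
  exact iSup_le fun n => anc_eq_prob_le μ _ z w

lemma avoidProb_eq_zero_step (μ : PMF ℕ+) {i : ℕ+} (hi : i ∈ μ.support) {z w : ℤ} (h : w < z)
    (h0 : avoidProb μ z w = 0) : avoidProb μ (z - (i : ℤ)) w = 0 := by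
  have h1 := mul_le_lintegral μ (fun j : ℕ+ => avoidProb μ (z - (j : ℤ)) w) i
  rw [← avoidProb_step μ h, h0] at h1
  exact (mul_eq_zero.mp (le_antisymm h1 bot_le)).resolve_left ((PMF.mem_support_iff _ _).mp hi)

lemma lintegral_eq_zero_of_support (μ : PMF ℕ+) {f : ℕ+ → ℝ≥0∞} (h : ∀ i ∈ μ.support, f i = 0) :
    ∫⁻ i, f i ∂μ.toMeasure = 0 := by
  rw [lintegral_eq_zero_iff .of_discrete]
  have h0 : μ.toMeasure μ.supportᶜ = 0 := by
    rw [PMF.toMeasure_apply_eq_zero_iff _ (.of_discrete)]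
    exact disjoint_compl_right
  filter_upwards [measure_eq_zero_iff_ae_notMem.mp h0] with i hi
  exact h i (not_not.mp hi)

/-- The set of pairs whose lines meet almost surely is closed under lowering either vertex by an
element of the support. Starting from diagonal pairs, the gcd hypothesis then reaches every pair. -/
lemma avoidProb_eq_zero_of_escapeProb (μ : PMF ℕ+)
    (hgcd : Nat.setGcd ((fun n : ℕ+ => (n : ℕ)) '' μ.support) = 1) (hq : escapeProb μ = 0)
    (z w : ℤ) : avoidProb μ z w = 0 := by
  have hdiag (i j : ℕ+) (hi : i ∈ μ.support) (hj : j ∈ μ.support) (z : ℤ) :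
      avoidProb μ (z - (i : ℤ)) (z - (j : ℤ)) = 0 := by
    have h1 := mul_le_lintegral μ (fun i : ℕ+ =>
      ∫⁻ j : ℕ+, avoidProb μ (-(i : ℤ)) (-(j : ℤ)) ∂μ.toMeasure) i
    rw [← escapeProb, hq] at h1
    have h2 := (mul_eq_zero.mp (le_antisymm h1 bot_le)).resolve_left
      ((PMF.mem_support_iff _ _).mp hi)
    have h3 := mul_le_lintegral μ (fun j : ℕ+ => avoidProb μ (-(i : ℤ)) (-(j : ℤ))) j
    rw [h2] at h3
    have h4 := (mul_eq_zero.mp (le_antisymm h3 bot_le)).resolve_left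
      ((PMF.mem_support_iff _ _).mp hj)
    have h5 := avoidProb_add_meetProb μ (-(i : ℤ)) (-(j : ℤ))
    rw [h4, zero_add, ← meetProb_add μ z] at h5
    have h6 := avoidProb_add_meetProb μ (-(i : ℤ) + z) (-(j : ℤ) + z)
    rw [h5] at h6
    have h7 := (ENNReal.add_left_inj ENNReal.one_ne_top).mp (h6.trans (zero_add 1).symm)
    rw [← h7]
    congr 1 <;> ring
  have hself (z : ℤ) : avoidProb μ z z = 0 := by simp [avoidProb, Meet.refl]
  have hself' {i : ℕ+} (hi : i ∈ μ.support) (z : ℤ) : avoidProb μ z (z - (i : ℤ)) = 0 := by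
    have h1 : (1 : ℤ) ≤ (i : ℤ) := by exact_mod_cast i.pos
    rw [avoidProb_step μ (by omega)]
    exact lintegral_eq_zero_of_support μ fun j hj => hdiag j i hj hi z
  -- Lowering the lower vertex: the higher line is run down until it hits `w` (then `hself'`) or
  -- falls below it, when `w` has become the higher vertex.
  have hright {i : ℕ+} (hi : i ∈ μ.support) (w z : ℤ) (hwz : w < z)
      (h0 : avoidProb μ z w = 0) : avoidProb μ z (w - (i : ℤ)) = 0 := by
    have h1 : (1 : ℤ) ≤ (i : ℤ) := by exact_mod_cast i.pos
    induction z using line_induction (w + 1) with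
    | below z hz => omega
    | step z hz ih =>
      rw [avoidProb_step μ (by omega)]
      refine lintegral_eq_zero_of_support μ fun j hj => ?_
      have h2 : (1 : ℤ) ≤ (j : ℤ) := by exact_mod_cast j.pos
      have h3 := avoidProb_eq_zero_step μ hj hwz h0
      rcases lt_trichotomy (z - (j : ℤ)) w with h4 | h4 | h4
      · rw [avoidProb_comm] at h3 ⊢
        exact avoidProb_eq_zero_step μ hi h4 h3
      · rw [h4]; exact hself' hi w
      · exact ih _ (by omega) h4 h3
  have hsub {i : ℕ+} (hi : i ∈ μ.support) (z w : ℤ) (h0 : avoidProb μ z w = 0) :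
      avoidProb μ (z - (i : ℤ)) w = 0 := by
    rcases lt_trichotomy z w with h | rfl | h
    · rw [avoidProb_comm] at h0 ⊢
      exact hright hi z w h h0
    · rw [avoidProb_comm]; exact hself' hi z
    · exact avoidProb_eq_zero_step μ hi h h0
  have hcl (a : ℕ) (ha : a ∈ AddSubmonoid.closure ((fun n : ℕ+ => (n : ℕ)) '' μ.support)) :
      ∀ z w : ℤ, avoidProb μ z w = 0 → avoidProb μ (z - a) w = 0 := by
    induction ha using AddSubmonoid.closure_induction with
    | mem a ha =>
      obtain ⟨d, hd, rfl⟩ := ha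
      exact hsub hd
    | zero => simp
    | add a b _ _ iha ihb =>
      intro z w h0
      rw [Nat.cast_add, ← sub_sub]
      exact ihb _ _ (iha _ _ h0)
  have hle (z w : ℤ) (hwz : w ≤ z) : avoidProb μ z w = 0 := by
    -- From the diagonal pair at `z + a`, one vertex is lowered by `a` to `z` and the other by `a +
    -- (z - w)` to `w`.
    obtain ⟨a, ha, hb⟩ := exists_closure_pair hgcd (z - w).toNat
    have h1 := hcl _ ha (z + a) (z + a) (hself _)
    rw [avoidProb_comm] at h1
    have h2 := hcl _ hb _ _ h1
    rw [avoidProb_comm] at h2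
    rw [← h2]
    congr 1
    · ring
    · omega
  rcases le_total w z with h | h
  · exact hle z w h
  · rw [avoidProb_comm]; exact hle w z h

lemma escapeProb_ne_zero (μ : PMF ℕ+)
    (hgcd : Nat.setGcd ((fun n : ℕ+ => (n : ℕ)) '' μ.support) = 1)
    (hinf : ∀ᵐ k ∂jumpLaw μ, Infinite (jumpGraph k).ConnectedComponent) : escapeProb μ ≠ 0 := by
  intro hq
  have h1 : ∀ᵐ k ∂jumpLaw μ, ∀ z w, Meet k z w := by
    rw [ae_all_iff]; intro z
    rw [ae_all_iff]; intro w
    exact avoidProb_eq_zero_of_escapeProb μ hgcd hq z w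
  obtain ⟨k, hk1, hk2⟩ := (h1.and hinf).exists
  have : Subsingleton (jumpGraph k).ConnectedComponent := by
    refine ⟨fun C D => ?_⟩
    induction C using SimpleGraph.ConnectedComponent.ind with | _ z
    induction D using SimpleGraph.ConnectedComponent.ind with | _ w
    exact SimpleGraph.ConnectedComponent.eq.mpr (reachable_iff_meet.mpr (hk1 z w))
  exact not_finite (jumpGraph k).ConnectedComponent

/-- Cauchy–Schwarz for the sum of products of visit probabilities: only `v ≤ w` contribute, so one
factor is the tail of a convergent series and the other is bounded uniformly in `w`. -/
lemma tendsto_meetProb (μ : PMF ℕ+)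
    (hgcd : Nat.setGcd ((fun n : ℕ+ => (n : ℕ)) '' μ.support) = 1)
    (hinf : ∀ᵐ k ∂jumpLaw μ, Infinite (jumpGraph k).ConnectedComponent) (z : ℤ) :
    Tendsto (fun w => meetProb μ z w) atBot (𝓝 0) := by
  have hq := escapeProb_ne_zero μ hgcd hinf
  set u := visitProb μ with hu
  -- The diagonal case of `escapeProb_mul_sum_le`, where the meeting probability is `1`.
  have hsum (w : ℤ) : ∑' v, u (w - v) * u (w - v) ≤ (escapeProb μ)⁻¹ := by
    refine ENNReal.summable.tsum_le_of_sum_le fun V => ?_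
    rw [ENNReal.le_inv_iff_mul_le, mul_comm]
    exact (escapeProb_mul_sum_le μ V w w).trans (by simp)
  have htail : Tendsto (fun w : ℤ => ∫⁻ v : ℤ, (if v ≤ w then u (z - v) else 0) ^ (2 : ℝ)
      ∂Measure.count) atBot (𝓝 (∫⁻ _ : ℤ, 0 ∂Measure.count)) := by
    refine tendsto_lintegral_filter_of_dominated_convergence (fun v => u (z - v) * u (z - v))
      (.of_forall fun w => .of_discrete) (.of_forall fun w => .of_forall fun v => ?_) ?_
      (.of_forall fun v => ?_)
    · simp only [ENNReal.rpow_two, sq]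
      split_ifs <;> simp
    · rw [lintegral_count]
      exact ((hsum z).trans_lt (ENNReal.inv_lt_top.mpr (pos_iff_ne_zero.mpr hq))).ne
    · refine tendsto_const_nhds.congr' ?_
      filter_upwards [eventually_lt_atBot v] with w hw
      simp [not_le.mpr hw]
  rw [lintegral_zero] at htail
  have hbound (w : ℤ) : meetProb μ z w ≤
      (∫⁻ v : ℤ, (if v ≤ w then u (z - v) else 0) ^ (2 : ℝ) ∂Measure.count) ^ (1 / 2 : ℝ) *
        ((escapeProb μ)⁻¹) ^ (1 / 2 : ℝ) := by
    refine (meetProb_le_tsum μ z w).trans ?_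
    have h1 : ∑' v, u (z - v) * u (w - v) =
        ∫⁻ v : ℤ, ((fun v => if v ≤ w then u (z - v) else 0) * fun v => u (w - v)) v
          ∂Measure.count := by
      rw [lintegral_count]
      refine tsum_congr fun v => ?_
      simp only [Pi.mul_apply]
      split_ifs with hv
      · rfl
      · rw [hu, visitProb_of_neg μ (show w - v < 0 by omega)]; simp
    rw [← hu, h1]
    refine (ENNReal.lintegral_mul_le_Lp_mul_Lq _ Real.HolderConjugate.two_two
      Measurable.of_discrete.aemeasurable Measurable.of_discrete.aemeasurable).trans ?_
    gcongr
    rw [lintegral_count]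
    simp only [ENNReal.rpow_two, sq]
    exact hsum w
  refine tendsto_of_tendsto_of_tendsto_of_le_of_le tendsto_const_nhds ?_ (fun w => zero_le) hbound
  have h2 := (htail.ennrpow_const (1 / 2 : ℝ))
  rw [ENNReal.zero_rpow_of_pos (by norm_num)] at h2
  have h3 := ENNReal.Tendsto.mul_const (b := ((escapeProb μ)⁻¹) ^ (1 / 2 : ℝ)) h2
    (.inr (ENNReal.rpow_ne_top_of_nonneg (by norm_num) (ENNReal.inv_ne_top.mpr hq)))
  rwa [zero_mul] at h3

/-! ### Asymptotic independence of ancestral lines that do not meet -/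

lemma jumpLaw_real_update (μ : PMF ℕ+) (z : ℤ) {E : Set (ℤ → ℕ+)} (hE : MeasurableSet E) :
    (jumpLaw μ).real E = ∫ j, (jumpLaw μ).real {k | Function.update k z j ∈ E} ∂μ.toMeasure := by
  have hm (j : ℕ+) : Measurable fun k : ℤ → ℕ+ => Function.update k z j := by fun_prop
  have h := integral_jumpLaw_update μ z (f := E.indicator 1) (measurable_one.indicator hE) (C := 1)
    fun k => by by_cases hk : k ∈ E <;> simp [hk]
  rw [integral_indicator_one hE] at h
  rw [h]
  refine integral_congr_ae (.of_forall fun j => ?_)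
  exact integral_indicator_one (hm j hE)

/-- The event that two of the ancestral lines started from `w` meet. -/
def someMeet {ι : Type*} (w : ι → ℤ) : Set (ℤ → ℕ+) :=
  {k | ∃ i i', i ≠ i' ∧ Meet k (w i) (w i')}

lemma measurableSet_someMeet {ι : Type*} [Countable ι] (w : ι → ℤ) :
    MeasurableSet (someMeet w) := by
  have : someMeet w = ⋃ i, ⋃ i', {k | i ≠ i' ∧ Meet k (w i) (w i')} := by
    ext k; simp [someMeet]
  rw [this]
  exact .iUnion fun i => .iUnion fun i' => (MeasurableSet.const _).inter (measurableSet_meet _ _)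

lemma update_mem_someMeet {ι : Type*} [DecidableEq ι] {w : ι → ℤ} {i₀ : ι}
    (hlt : ∀ i, i ≠ i₀ → w i < w i₀) (k : ℤ → ℕ+) (j : ℕ+) :
    Function.update k (w i₀) j ∈ someMeet w ↔
      k ∈ someMeet (Function.update w i₀ (w i₀ - (j : ℤ))) := by
  simp only [someMeet, Set.mem_ofPred_eq]
  refine exists₂_congr fun i i' => and_congr_right fun hne => ?_
  by_cases hi : i = i₀
  · subst hi
    rw [Function.update_self, Function.update_of_ne hne.symm, meet_update (hlt _ hne.symm)]
  · by_cases hi' : i' = i₀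
    · subst hi'
      rw [Function.update_self, Function.update_of_ne hne, meet_comm, meet_update (hlt _ hne),
        meet_comm]
    · rw [Function.update_of_ne hi, Function.update_of_ne hi']
      refine meet_congr fun v hv => ?_
      have h1 := hlt _ hi
      have h2 := hlt _ hi'
      rw [Function.update_of_ne (by omega)]

lemma integral_anc_mem (μ : PMF ℕ+) {f : ℤ → ℝ} (h0 : ∀ z, 0 ≤ f z) (h1 : ∀ z, f z ≤ 1)
    (y z : ℤ) : 0 ≤ ∫ k, f (anc y k z) ∂jumpLaw μ ∧ ∫ k, f (anc y k z) ∂jumpLaw μ ≤ 1 := by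
  refine ⟨integral_nonneg fun _ => h0 _, ?_⟩
  refine (integral_mono_of_nonneg (.of_forall fun _ => h0 _) (integrable_const 1)
    (.of_forall fun _ => h1 _)).trans ?_
  simp

lemma abs_le_one_of_mem {t : ℝ} (h0 : 0 ≤ t) (h1 : t ≤ 1) : |t| ≤ 1 := by rwa [abs_of_nonneg h0]

/-- Lines are independent until two of them meet. No coupling is built: the joint expectation, the
product of expectations and the error bound all become averages over the jump of the highest vertex,
so the inequality is inherited from lower starting points. -/
lemma decoupling (μ : PMF ℕ+) {ι : Type*} [Fintype ι] {f : ℤ → ℝ} (h0 : ∀ z, 0 ≤ f z)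
    (h1 : ∀ z, f z ≤ 1) (y : ℤ) (w : ι → ℤ) :
    |∫ k, ∏ i, f (anc y k (w i)) ∂jumpLaw μ - ∏ i, ∫ k, f (anc y k (w i)) ∂jumpLaw μ| ≤
      (jumpLaw μ).real (someMeet w) := by
  classical
  have hprod (v : ι → ℤ) : 0 ≤ ∏ i, f (v i) ∧ ∏ i, f (v i) ≤ 1 :=
    ⟨Finset.prod_nonneg fun i _ => h0 _, Finset.prod_le_one (fun i _ => h0 _) fun i _ => h1 _⟩
  have hmeas (y : ℤ) (v : ι → ℤ) : Measurable fun k : ℤ → ℕ+ => ∏ i, f (anc y k (v i)) :=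
    Finset.measurable_prod _ fun i _ =>
      (Measurable.of_discrete (f := f)).comp (measurable_anc y (v i))
  have hF (v : ι → ℤ) : 0 ≤ ∫ k, ∏ i, f (anc y k (v i)) ∂jumpLaw μ ∧
      ∫ k, ∏ i, f (anc y k (v i)) ∂jumpLaw μ ≤ 1 := by
    refine ⟨integral_nonneg fun _ => (hprod _).1, ?_⟩
    refine (integral_mono_of_nonneg (.of_forall fun _ => (hprod _).1) (integrable_const 1)
      (.of_forall fun _ => (hprod _).2)).trans ?_
    simp
  have hG (v : ι → ℤ) : 0 ≤ ∏ i, ∫ k, f (anc y k (v i)) ∂jumpLaw μ ∧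
      ∏ i, ∫ k, f (anc y k (v i)) ∂jumpLaw μ ≤ 1 :=
    ⟨Finset.prod_nonneg fun i _ => (integral_anc_mem μ h0 h1 _ _).1,
      Finset.prod_le_one (fun i _ => (integral_anc_mem μ h0 h1 _ _).1)
        fun i _ => (integral_anc_mem μ h0 h1 _ _).2⟩
  induction hN : ∑ i, (w i - y + 1).toNat using Nat.strong_induction_on generalizing w with
  | _ N ih =>
    by_cases hbelow : ∀ i, w i < y
    · simp only [anc_of_lt _ (hbelow _), integral_const, probReal_univ, one_smul, sub_self, abs_zero]
      exact measureReal_nonneg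
    · push Not at hbelow
      obtain ⟨i₁, hi₁⟩ := hbelow
      obtain ⟨i₀, -, hmax⟩ := Finset.exists_max_image Finset.univ w ⟨i₁, Finset.mem_univ _⟩
      have hy : y ≤ w i₀ := hi₁.trans (hmax i₁ (Finset.mem_univ _))
      -- If the highest vertex is repeated, a meeting is certain and the bound is the trivial `1`.
      -- Otherwise it is strictly highest and no other line uses its jump.
      by_cases hdup : ∃ i, i ≠ i₀ ∧ w i = w i₀
      · obtain ⟨i, hi, hw⟩ := hdup
        have huniv : someMeet w = Set.univ := by
          ext k
          simp only [someMeet, Set.mem_ofPred_eq, Set.mem_univ, iff_true]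
          exact ⟨i, i₀, hi, hw ▸ .refl k _⟩
        rw [huniv, probReal_univ, abs_le]
        constructor <;> linarith [(hF w).1, (hF w).2, (hG w).1, (hG w).2]
      · have hlt : ∀ i, i ≠ i₀ → w i < w i₀ := fun i hi =>
          lt_of_le_of_ne (hmax i (Finset.mem_univ _)) fun h => hdup ⟨i, hi, h⟩
        set w' : ℕ+ → ι → ℤ := fun j => Function.update w i₀ (w i₀ - (j : ℤ)) with hw'
        have hanc (k : ℤ → ℕ+) (j : ℕ+) (i : ι) :
            anc y (Function.update k (w i₀) j) (w i) = anc y k (w' j i) := by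
          by_cases hi : i = i₀
          · subst hi; simp only [hw', Function.update_self, anc_update hy]
          · simp only [hw', Function.update_of_ne hi, anc_update_of_lt (hlt i hi)]
        have hFstep : ∫ k, ∏ i, f (anc y k (w i)) ∂jumpLaw μ =
            ∫ j, ∫ k, ∏ i, f (anc y k (w' j i)) ∂jumpLaw μ ∂μ.toMeasure := by
          rw [integral_jumpLaw_update μ (w i₀) (hmeas y w) (C := 1)
            fun k => abs_le_one_of_mem (hprod _).1 (hprod _).2]
          simp only [hanc]
        have hgstep : ∫ k, f (anc y k (w i₀)) ∂jumpLaw μ =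
            ∫ j : ℕ+, ∫ k, f (anc y k (w i₀ - (j : ℤ))) ∂jumpLaw μ ∂μ.toMeasure := by
          have hm : Measurable fun k : ℤ → ℕ+ => f (anc y k (w i₀)) :=
            (Measurable.of_discrete (f := f)).comp (measurable_anc y (w i₀))
          rw [integral_jumpLaw_update μ (w i₀) hm (C := 1) fun k => abs_le_one_of_mem (h0 _) (h1 _)]
          simp only [anc_update hy]
        have hGstep : ∏ i, ∫ k, f (anc y k (w i)) ∂jumpLaw μ =
            ∫ j, ∏ i, ∫ k, f (anc y k (w' j i)) ∂jumpLaw μ ∂μ.toMeasure := by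
          have h2 (j : ℕ+) : ∏ i, ∫ k, f (anc y k (w' j i)) ∂jumpLaw μ =
              (∫ k, f (anc y k (w i₀ - (j : ℤ))) ∂jumpLaw μ) *
                ∏ i ∈ Finset.univ.erase i₀, ∫ k, f (anc y k (w i)) ∂jumpLaw μ := by
            rw [← Finset.mul_prod_erase _ _ (Finset.mem_univ i₀)]
            congr 1
            · simp only [hw', Function.update_self]
            · refine Finset.prod_congr rfl fun i hi => ?_
              simp only [hw', Function.update_of_ne (Finset.ne_of_mem_erase hi)]
          simp only [h2]
          rw [integral_mul_const, ← hgstep, Finset.mul_prod_erase _ (fun i =>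
            ∫ k, f (anc y k (w i)) ∂jumpLaw μ) (Finset.mem_univ i₀)]
        have hdstep : (jumpLaw μ).real (someMeet w) =
            ∫ j, (jumpLaw μ).real (someMeet (w' j)) ∂μ.toMeasure := by
          rw [jumpLaw_real_update μ (w i₀) (measurableSet_someMeet w)]
          simp only [update_mem_someMeet hlt, Set.ofPred_mem_eq, hw']
        have hint {g : ℕ+ → ℝ} (hg : ∀ j, 0 ≤ g j ∧ g j ≤ 1) : Integrable g μ.toMeasure :=
          .of_bound Measurable.of_discrete.aestronglyMeasurable 1
            (.of_forall fun j => abs_le_one_of_mem (hg j).1 (hg j).2)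
        rw [hFstep, hGstep, hdstep, ← integral_sub (hint fun j => hF _) (hint fun j => hG _)]
        refine abs_integral_le_integral_abs.trans (integral_mono
          ((hint fun j => hF _).sub (hint fun j => hG _)).abs
          (hint fun j => ⟨measureReal_nonneg, measureReal_le_one⟩) fun j => ?_)
        refine ih _ ?_ (w' j) rfl
        rw [← hN]
        have hj : (1 : ℤ) ≤ (j : ℤ) := by exact_mod_cast j.pos
        refine Finset.sum_lt_sum (fun i _ => ?_) ⟨i₀, Finset.mem_univ _, ?_⟩
        · by_cases hi : i = i₀
          · subst hi; simp only [hw', Function.update_self]; omega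
          · simp only [hw', Function.update_of_ne hi, le_refl]
        · simp only [hw', Function.update_self]; omega

/-- The event that the ancestral lines of two different vertices of `T` meet. -/
def pairMeet (T : Finset ℤ) : Set (ℤ → ℕ+) :=
  {k | ∃ a ∈ T, ∃ b ∈ T, a ≠ b ∧ Meet k a b}

lemma someMeet_coe (T : Finset ℤ) : someMeet (fun z : T => (z : ℤ)) = pairMeet T := by
  ext k
  simp [someMeet, pairMeet, and_assoc]

/-- Conditioning on the remote past leaves every vertex with the value `1` with probability
close to `p`. -/
def PastLimit (μ : PMF ℕ+) (ν : Measure (ℤ → ℤˣ)) (p : ℝ) : Prop :=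
  ∀ z, Tendsto (fun y => ∫ X, |condPlus μ y z X - p| ∂ν) atBot (𝓝 0)

lemma abs_prod_sub_pow_le (S : Finset ℤ) {a : ℤ → ℝ} (h0 : ∀ z, 0 ≤ a z) (h1 : ∀ z, a z ≤ 1)
    {p : ℝ} (hp0 : 0 ≤ p) (hp1 : p ≤ 1) :
    |∏ z ∈ S, a z - p ^ S.card| ≤ ∑ z ∈ S, |a z - p| := by
  classical
  induction S using Finset.induction_on with
  | empty => simp
  | insert z S hz ih =>
    rw [Finset.prod_insert hz, Finset.sum_insert hz, Finset.card_insert_of_notMem hz, pow_succ]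
    have h2 : a z * ∏ z ∈ S, a z - p ^ S.card * p =
        (a z - p) * ∏ z ∈ S, a z + p * (∏ z ∈ S, a z - p ^ S.card) := by ring
    rw [h2]
    refine (abs_add_le _ _).trans (add_le_add ?_ ?_)
    · rw [abs_mul]
      refine mul_le_of_le_one_right (abs_nonneg _) (abs_le_one_of_mem
        (Finset.prod_nonneg fun i _ => h0 i) (Finset.prod_le_one (fun i _ => h0 i) fun i _ => h1 i))
    · rw [abs_mul, abs_of_nonneg hp0]
      exact (mul_le_of_le_one_left (abs_nonneg _) hp1).trans ih

lemma integrable_of_abs_le {Ω : Type*} [MeasurableSpace Ω] {ν : Measure Ω} [IsFiniteMeasure ν]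
    {f : Ω → ℝ} (hf : Measurable f) {C : ℝ} (hC : ∀ X, |f X| ≤ C) : Integrable f ν :=
  .of_bound hf.aestronglyMeasurable C (.of_forall hC)

/-- Given the spins below `y`, decoupling replaces the probability of all ones on `T` by a product
of conditional probabilities, at a cost uniform in `y`. Each factor tends to `p` as `y → -∞`. -/
lemma IsGibbs.abs_plusProb_sub_pow_le {μ : PMF ℕ+} {ν : Measure (ℤ → ℤˣ)} (h : IsGibbs μ ν)
    {p : ℝ} (hp0 : 0 ≤ p) (hp1 : p ≤ 1) (hlim : PastLimit μ ν p) (T : Finset ℤ) :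
    |plusProb ν T - p ^ T.card| ≤ (jumpLaw μ).real (pairMeet T) := by
  have := h.isProbabilityMeasure
  have hprod (y : ℤ) (X : ℤ → ℤˣ) : |∏ z ∈ T, condPlus μ y z X| ≤ 1 :=
    abs_le_one_of_mem (Finset.prod_nonneg fun i _ => condPlus_nonneg ..)
      (Finset.prod_le_one (fun i _ => condPlus_nonneg ..) fun i _ => condPlus_le_one ..)
  have hprodm (y : ℤ) : Measurable fun X => ∏ z ∈ T, condPlus μ y z X :=
    Finset.measurable_prod _ fun z _ => measurable_condPlus μ y z
  have habs (y z : ℤ) : Integrable (fun X => |condPlus μ y z X - p|) ν :=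
    ((integrable_of_abs_le (measurable_condPlus μ y z) (abs_condPlus_le μ y z)).sub
      (integrable_const p)).abs
  have hpm (y : ℤ) : Measurable fun q : (ℤ → ℤˣ) × (ℤ → ℕ+) => ∏ z ∈ T, ind q.1 (anc y q.2 z) :=
    Finset.measurable_prod _ fun z _ => measurable_ind_anc y z
  have hp01 (y : ℤ) (q : (ℤ → ℤˣ) × (ℤ → ℕ+)) : |∏ z ∈ T, ind q.1 (anc y q.2 z)| ≤ 1 :=
    abs_le_one_of_mem (Finset.prod_nonneg fun i _ => ind_nonneg ..)
      (Finset.prod_le_one (fun i _ => ind_nonneg ..) fun i _ => ind_le_one ..)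
  have hbound (y : ℤ) : |plusProb ν T - p ^ T.card| ≤ (jumpLaw μ).real (pairMeet T) +
      ∑ z ∈ T, ∫ X, |condPlus μ y z X - p| ∂ν := by
    have h1 : plusProb ν T = ∫ X, ∫ k, ∏ z ∈ T, ind X (anc y k z) ∂jumpLaw μ ∂ν := by
      rw [plusProb_eq_integral, h.integral_eq y (measurable_prod_ind T) (abs_prod_ind_le T)]
      rfl
    have h2 : |∫ X, ∫ k, ∏ z ∈ T, ind X (anc y k z) ∂jumpLaw μ ∂ν -
        ∫ X, ∏ z ∈ T, condPlus μ y z X ∂ν| ≤ (jumpLaw μ).real (pairMeet T) := by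
      rw [← integral_sub ((integrable_of_abs_le (hpm y) (hp01 y)).integral_prod_left
        (μ := ν) (ν := jumpLaw μ)) (integrable_of_abs_le (hprodm y) (hprod y))]
      have h3 := norm_integral_le_of_norm_le_const (μ := ν) (C := (jumpLaw μ).real (pairMeet T))
        (f := fun X => ∫ k, ∏ z ∈ T, ind X (anc y k z) ∂jumpLaw μ - ∏ z ∈ T, condPlus μ y z X)
        (.of_forall fun X => ?_)
      · simpa using h3
      · have h4 := decoupling μ (ind_nonneg X) (ind_le_one X) y fun z : T => (z : ℤ)
        rw [someMeet_coe, Finset.prod_coe_sort T fun z => ∫ k, ind X (anc y k z) ∂jumpLaw μ] at h4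
        have h5 (k : ℤ → ℕ+) : ∏ i : T, ind X (anc y k i) = ∏ z ∈ T, ind X (anc y k z) :=
          Finset.prod_coe_sort T fun z => ind X (anc y k z)
        simp only [h5] at h4
        exact h4
    have h3 : |∫ X, ∏ z ∈ T, condPlus μ y z X ∂ν - p ^ T.card| ≤
        ∑ z ∈ T, ∫ X, |condPlus μ y z X - p| ∂ν := by
      rw [← integral_finsetSum _ fun z _ => habs y z]
      have h4 : ∫ X, ∏ z ∈ T, condPlus μ y z X ∂ν - p ^ T.card =
          ∫ X, (∏ z ∈ T, condPlus μ y z X - p ^ T.card) ∂ν := by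
        rw [integral_sub (integrable_of_abs_le (hprodm y) (hprod y)) (integrable_const _)]
        simp
      rw [h4]
      refine abs_integral_le_integral_abs.trans (integral_mono
        ((integrable_of_abs_le (hprodm y) (hprod y)).sub (integrable_const _)).abs
        (integrable_finsetSum _ fun z _ => habs y z) fun X => ?_)
      exact abs_prod_sub_pow_le T (fun z => condPlus_nonneg ..) (fun z => condPlus_le_one ..)
        hp0 hp1
    rw [h1]
    exact (abs_sub_le _ _ _).trans (add_le_add h2 h3)
  have hlim' : Tendsto (fun y => (jumpLaw μ).real (pairMeet T) +
      ∑ z ∈ T, ∫ X, |condPlus μ y z X - p| ∂ν) atBot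
      (𝓝 ((jumpLaw μ).real (pairMeet T) + ∑ z ∈ T, 0)) :=
    tendsto_const_nhds.add (tendsto_finsetSum _ fun z _ => hlim z)
  rw [Finset.sum_const_zero, add_zero] at hlim'
  exact ge_of_tendsto' hlim' hbound

/-! ### Splitting the jumps at a level, and uniqueness given the past limit -/

/-- Jumps above level `x` taken from the first and below from the second environment. -/
noncomputable def splice (x : ℤ) (q : (ℤ → ℕ+) × (ℤ → ℕ+)) : ℤ → ℕ+ :=
  fun v => if x ≤ v then q.1 v else q.2 v

lemma splice_eq_piecewise (x : ℤ) :
    splice x = fun q => (Set.Ici x).piecewise q.1 q.2 := by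
  funext q v
  simp [splice, Set.piecewise]

lemma measurable_splice (x : ℤ) : Measurable (splice x) := by
  rw [splice_eq_piecewise]; exact measurable_piecewise_pair _

lemma jumpLaw_map_splice (μ : PMF ℕ+) (x : ℤ) :
    ((jumpLaw μ).prod (jumpLaw μ)).map (splice x) = jumpLaw μ := by
  rw [splice_eq_piecewise]; exact jumpLaw_map_piecewise μ _

lemma anc_splice (x : ℤ) (q : (ℤ → ℕ+) × (ℤ → ℕ+)) (z : ℤ) :
    anc x (splice x q) z = anc x q.1 z :=
  anc_congr fun v hv _ => by simp [splice, hv]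

lemma meet_splice {x : ℤ} (q : (ℤ → ℕ+) × (ℤ → ℕ+)) {z w : ℤ} (hz : z < x) (hw : w < x) :
    Meet (splice x q) z w ↔ Meet q.2 z w :=
  meet_congr fun v hv => by simp [splice, show ¬ x ≤ v by omega]

lemma meet_splice_iff {x : ℤ} (q : (ℤ → ℕ+) × (ℤ → ℕ+)) {a b : ℤ} :
    Meet (splice x q) a b ↔ Meet q.2 (anc x q.1 a) (anc x q.1 b) := by
  rw [← meet_splice q (anc_lt x q.1 a) (anc_lt x q.1 b)]
  have ha := meet_anc x (splice x q) a
  have hb := meet_anc x (splice x q) b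
  rw [anc_splice] at ha hb
  exact ⟨fun h => (ha.symm.trans h).trans hb, fun h => (ha.trans h).trans hb.symm⟩

/-- The event that some ancestral lines from `S` are distinct below level `x` but meet later. -/
def lateMeet (x : ℤ) (S : Finset ℤ) : Set (ℤ → ℕ+) :=
  {k | ∃ a ∈ S, ∃ b ∈ S, anc x k a ≠ anc x k b ∧ Meet k a b}

lemma measurableSet_lateMeet (x : ℤ) (S : Finset ℤ) : MeasurableSet (lateMeet x S) := by
  have : lateMeet x S = ⋃ a ∈ S, ⋃ b ∈ S, {k | anc x k a = anc x k b}ᶜ ∩ {k | Meet k a b} := by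
    ext k; simp [lateMeet, and_left_comm]
  rw [this]
  exact .biUnion S.countable_toSet fun a _ => .biUnion S.countable_toSet fun b _ =>
    (measurableSet_anc_eq x a b).compl.inter (measurableSet_meet a b)

/-- For each fixed realization, the finitely many pairs of `S` that ever meet have all done so above
a sufficiently low level; dominated convergence finishes. -/
lemma tendsto_lateMeet (μ : PMF ℕ+) (S : Finset ℤ) :
    Tendsto (fun x => (jumpLaw μ).real (lateMeet x S)) atBot (𝓝 0) := by
  have h : Tendsto (fun x => ∫ k, (lateMeet x S).indicator (1 : (ℤ → ℕ+) → ℝ) k ∂jumpLaw μ) atBot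
      (𝓝 (∫ _, 0 ∂jumpLaw μ)) := by
    refine tendsto_integral_filter_of_dominated_convergence (fun _ => 1)
      (.of_forall fun x =>
        (measurable_one.indicator (measurableSet_lateMeet x S)).aestronglyMeasurable)
      (.of_forall fun x => .of_forall fun k => ?_) (integrable_const _) (.of_forall fun k => ?_)
    · by_cases hk : k ∈ lateMeet x S <;> simp [hk]
    · refine tendsto_const_nhds.congr' ?_
      have h1 : ∀ᶠ x in atBot, ∀ a ∈ S, ∀ b ∈ S, Meet k a b → anc x k a = anc x k b := by
        rw [Finset.eventually_all]; intro a _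
        rw [Finset.eventually_all]; intro b _
        by_cases hm : Meet k a b
        · filter_upwards [hm.eventually] with x hx _ using hx
        · exact .of_forall fun x h => (hm h).elim
      filter_upwards [h1] with x hx
      rw [Set.indicator_of_notMem]
      rintro ⟨a, ha, b, hb, hne, hm⟩
      exact hne (hx a ha b hb hm)
  rw [integral_zero] at h
  refine h.congr fun x => ?_
  exact integral_indicator_one (measurableSet_lateMeet x S)

/-- The Markov property at level `x`: once the ancestors of `S` below `x` are known, their later
meetings are governed by an independent environment. -/
lemma lateMeet_eq (μ : PMF ℕ+) (x : ℤ) (S : Finset ℤ) :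
    (jumpLaw μ).real (lateMeet x S) =
      ∫ k, (jumpLaw μ).real (pairMeet (S.image (anc x k))) ∂jumpLaw μ := by
  rw [integral_eq_lintegral_of_nonneg_ae (.of_forall fun k => measureReal_nonneg)
    (measurable_image_anc x S fun T => (jumpLaw μ).real (pairMeet T)).aestronglyMeasurable,
    measureReal_def]
  nth_rw 1 [← jumpLaw_map_splice μ x]
  rw [Measure.map_apply (measurable_splice x) (measurableSet_lateMeet x S),
    Measure.prod_apply (measurable_splice x (measurableSet_lateMeet x S))]
  congr 1
  refine lintegral_congr fun k => ?_
  rw [ofReal_measureReal]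
  congr 1
  ext k'
  simp only [Set.mem_preimage, lateMeet, pairMeet, Set.mem_ofPred_eq, Finset.mem_image,
    exists_exists_and_eq_and]
  refine exists_congr fun a => and_congr_right fun _ => exists_congr fun b =>
    and_congr_right fun _ => ?_
  rw [anc_splice, anc_splice, meet_splice_iff]

/-- A Gibbs measure with trivial limits of one-point probabilities is determined by that limit. -/
lemma IsGibbs.eq_of_pastLimit {μ : PMF ℕ+} {ν ν' : Measure (ℤ → ℤˣ)} (h : IsGibbs μ ν)
    (h' : IsGibbs μ ν') {p : ℝ} (hp0 : 0 ≤ p) (hp1 : p ≤ 1) (hlim : PastLimit μ ν p)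
    (hlim' : PastLimit μ ν' p) : ν = ν' := by
  have := h.isProbabilityMeasure
  have := h'.isProbabilityMeasure
  refine ext_of_plusProb fun S => ?_
  have hint {g : Finset ℤ → ℝ} (hg : ∀ T, |g T| ≤ 1) (x : ℤ) :
      Integrable (fun k => g (S.image (anc x k))) (jumpLaw μ) :=
    integrable_of_abs_le (measurable_image_anc x S g) fun k => hg _
  have hδ (T : Finset ℤ) : |(jumpLaw μ).real (pairMeet T)| ≤ 1 :=
    abs_le_one_of_mem measureReal_nonneg measureReal_le_one
  -- Both measures are compared with `p` to the number of ancestors of `S`; each comparison costs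
  -- the probability of a late meeting, whence the factor `2`.
  have hbound (x : ℤ) :
      |plusProb ν S - plusProb ν' S| ≤ 2 * (jumpLaw μ).real (lateMeet x S) := by
    rw [h.plusProb_eq x S, h'.plusProb_eq x S, lateMeet_eq, ← integral_const_mul,
      ← integral_sub (hint (abs_plusProb_le ν) x) (hint (abs_plusProb_le ν') x)]
    refine abs_integral_le_integral_abs.trans (integral_mono
      ((hint (abs_plusProb_le ν) x).sub (hint (abs_plusProb_le ν') x)).abs
      ((hint hδ x).const_mul 2) fun k => ?_)
    have h1 := abs_le.mp (h.abs_plusProb_sub_pow_le hp0 hp1 hlim (S.image (anc x k)))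
    have h2 := abs_le.mp (h'.abs_plusProb_sub_pow_le hp0 hp1 hlim' (S.image (anc x k)))
    simp only [abs_le]
    constructor <;> linarith [h1.1, h1.2, h2.1, h2.2]
  have h1 := ge_of_tendsto' ((tendsto_lateMeet μ S).const_mul 2) hbound
  rw [mul_zero] at h1
  exact sub_eq_zero.mp (abs_nonpos_iff.mp h1)

/-! ### The measures `λ_p` -/

lemma card_image_congr {α β γ : Type*} [DecidableEq α] [DecidableEq β] [DecidableEq γ]
    (S : Finset α) {f : α → β} {g : α → γ} (h : ∀ a ∈ S, ∀ b ∈ S, f a = f b ↔ g a = g b) :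
    (S.image f).card = (S.image g).card := by
  induction S using Finset.induction_on with
  | empty => simp
  | insert a S ha ih =>
    have ih' := ih fun x hx y hy => h x (Finset.mem_insert_of_mem hx) y (Finset.mem_insert_of_mem hy)
    have hmem : f a ∈ S.image f ↔ g a ∈ S.image g := by
      simp only [Finset.mem_image]
      exact exists_congr fun b => and_congr_right fun hb =>
        h b (Finset.mem_insert_of_mem hb) a (Finset.mem_insert_self _ _)
    rw [Finset.image_insert, Finset.image_insert, Finset.card_insert_eq_ite,
      Finset.card_insert_eq_ite, ih']
    simp only [hmem]

open Classical in
/-- The number of components of the graph that contain a vertex of `S`. -/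
noncomputable def numComp (k : ℤ → ℕ+) (S : Finset ℤ) : ℕ :=
  (S.image (jumpGraph k).connectedComponentMk).card

lemma component_eq_iff {k : ℤ → ℕ+} {a b : ℤ} :
    (jumpGraph k).connectedComponentMk a = (jumpGraph k).connectedComponentMk b ↔ Meet k a b :=
  SimpleGraph.ConnectedComponent.eq.trans reachable_iff_meet

lemma eventually_card_image_anc (k : ℤ → ℕ+) (S : Finset ℤ) :
    ∀ᶠ x in atBot, (S.image (anc x k)).card = numComp k S := by
  classical
  have h1 : ∀ᶠ x in atBot, ∀ a ∈ S, ∀ b ∈ S, Meet k a b → anc x k a = anc x k b := by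
    rw [Finset.eventually_all]; intro a _
    rw [Finset.eventually_all]; intro b _
    by_cases hm : Meet k a b
    · filter_upwards [hm.eventually] with x hx _ using hx
    · exact .of_forall fun x h => (hm h).elim
  filter_upwards [h1] with x hx
  refine card_image_congr S fun a ha b hb => ?_
  rw [component_eq_iff]
  exact ⟨fun h => ⟨x, h⟩, hx a ha b hb⟩

/-- The component type varies with `k`, so measurability is obtained by writing the count as a limit
of numbers of distinct ancestors. -/
lemma measurable_numComp (S : Finset ℤ) : Measurable fun k => numComp k S := by
  refine measurable_of_tendsto_metrizable' atBot
    (fun x : ℤ => measurable_image_anc x S Finset.card) (tendsto_pi_nhds.mpr fun k => ?_)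
  exact tendsto_const_nhds.congr' ((eventually_card_image_anc k S).mono fun x hx => hx.symm)

lemma numComp_splice (x : ℤ) (q : (ℤ → ℕ+) × (ℤ → ℕ+)) (S : Finset ℤ) :
    numComp (splice x q) S = numComp q.2 (S.image (anc x q.1)) := by
  classical
  rw [numComp, numComp, Finset.image_image]
  refine card_image_congr S fun a _ b _ => ?_
  rw [component_eq_iff, meet_splice_iff, Function.comp, Function.comp, component_eq_iff]

lemma spinLaw_one (p : unitInterval) : spinLaw p {s | s = 1} = ENNReal.ofReal p := by
  have h : (-1 : ℤˣ) ∉ {s : ℤˣ | s = 1} := by simp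
  have h' : (1 : ℤˣ) ∈ {s : ℤˣ | s = 1} := rfl
  rw [spinLaw, Measure.add_apply, Measure.smul_apply, Measure.smul_apply,
    Measure.dirac_apply' _ measurableSet_eq_one, Measure.dirac_apply' _ measurableSet_eq_one,
    Set.indicator_of_mem h', Set.indicator_of_notMem h]
  simp

lemma measurable_colouring (G : SimpleGraph ℤ) :
    Measurable fun (ξ : G.ConnectedComponent → ℤˣ) z => ξ (G.connectedComponentMk z) :=
  measurable_pi_lambda _ fun _ => measurable_pi_apply _

instance (p : unitInterval) (G : SimpleGraph ℤ) : IsProbabilityMeasure (colourLaw p G) :=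
  Measure.isProbabilityMeasure_map (measurable_colouring G).aemeasurable

lemma colourLaw_allOne (p : unitInterval) (k : ℤ → ℕ+) (S : Finset ℤ) :
    colourLaw p (jumpGraph k) (allOne S) = ENNReal.ofReal p ^ numComp k S := by
  classical
  rw [colourLaw, Measure.map_apply (measurable_colouring _) (measurableSet_allOne S)]
  have h : (fun (ξ : (jumpGraph k).ConnectedComponent → ℤˣ) z =>
      ξ ((jumpGraph k).connectedComponentMk z)) ⁻¹' allOne S =
      Set.pi (S.image (jumpGraph k).connectedComponentMk : Finset _) fun _ => {s | s = 1} := by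
    ext ξ
    simp [allOne]
  rw [h, Measure.infinitePi_pi _ fun _ _ => measurableSet_eq_one]
  simp only [spinLaw_one, Finset.prod_const, numComp]

lemma measurable_colourLaw (p : unitInterval) :
    Measurable fun k : ℤ → ℕ+ => colourLaw p (jumpGraph k) := by
  refine Measurable.measure_of_isPiSystem_of_isProbabilityMeasure generateFrom_allOne
    isPiSystem_allOne ?_
  rintro _ ⟨S, rfl⟩
  simp only [colourLaw_allOne]
  exact (Measurable.of_discrete (f := fun n : ℕ => ENNReal.ofReal p ^ n)).comp
    (measurable_numComp S)

instance (μ : PMF ℕ+) (p : unitInterval) : IsProbabilityMeasure (lambdaLaw μ p) := by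
  refine ⟨?_⟩
  rw [lambdaLaw, Measure.bind_apply .univ (measurable_colourLaw p).aemeasurable]
  simp

lemma plusProb_lambdaLaw (μ : PMF ℕ+) (p : unitInterval) (S : Finset ℤ) :
    plusProb (lambdaLaw μ p) S = ∫ k, (p : ℝ) ^ numComp k S ∂jumpLaw μ := by
  have hm : Measurable fun k => (p : ℝ) ^ numComp k S :=
    (Measurable.of_discrete (f := fun n : ℕ => (p : ℝ) ^ n)).comp (measurable_numComp S)
  rw [integral_eq_lintegral_of_nonneg_ae (.of_forall fun k => pow_nonneg p.2.1 _)
    hm.aestronglyMeasurable, plusProb, measureReal_def, lambdaLaw,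
    Measure.bind_apply (measurableSet_allOne S) (measurable_colourLaw p).aemeasurable]
  simp only [colourLaw_allOne, ENNReal.ofReal_pow p.2.1]

/-- Vertices and their ancestors below `x` lie in the same components, and those components can be
read off from an independent copy of the jumps below `x`. -/
lemma isGibbs_lambdaLaw (μ : PMF ℕ+) (p : unitInterval) : IsGibbs μ (lambdaLaw μ p) := by
  refine isGibbs_of_plusProb μ _ fun x S => ?_
  simp only [plusProb_lambdaLaw]
  have hm : Measurable fun k => (p : ℝ) ^ numComp k S :=
    (Measurable.of_discrete (f := fun n : ℕ => (p : ℝ) ^ n)).comp (measurable_numComp S)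
  conv_lhs => rw [← jumpLaw_map_splice μ x]
  rw [integral_map (measurable_splice x).aemeasurable hm.aestronglyMeasurable, integral_prod]
  · simp only [numComp_splice]
  · refine integrable_of_abs_le (hm.comp (measurable_splice x)) (C := 1) fun q => ?_
    exact abs_le_one_of_mem (pow_nonneg p.2.1 _) (pow_le_one₀ p.2.1 p.2.2)

lemma integral_sub_const_mul_add {Ω : Type*} [MeasurableSpace Ω] {ν : Measure Ω}
    [IsProbabilityMeasure ν] {f g : Ω → ℝ} (hf : Integrable f ν) (hg : Integrable g ν) (b d : ℝ) :
    ∫ X, (f X - b * g X + d) ∂ν = ∫ X, f X ∂ν - b * ∫ X, g X ∂ν + d := by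
  have h : Integrable (fun X => f X - b * g X) ν := hf.sub (hg.const_mul b)
  rw [integral_add h (integrable_const _), integral_sub hf (hg.const_mul b), integral_const_mul]
  simp

lemma integral_abs_le_sqrt {Ω : Type*} [MeasurableSpace Ω] {ν : Measure Ω}
    [IsProbabilityMeasure ν] {f : Ω → ℝ} (hf : Measurable f) {C : ℝ} (hC : ∀ X, |f X| ≤ C) :
    ∫ X, |f X| ∂ν ≤ √(∫ X, f X ^ 2 ∂ν) := by
  apply Real.le_sqrt_of_sq_le
  set c := ∫ X, |f X| ∂ν with hc
  have h1 : Integrable (fun X => |f X|) ν := (integrable_of_abs_le hf hC).abs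
  have h2 : Integrable (fun X => f X ^ 2) ν := by
    refine integrable_of_abs_le (hf.pow_const 2) (C := C ^ 2) fun X => ?_
    rw [abs_pow]
    exact pow_le_pow_left₀ (abs_nonneg _) (hC X) 2
  have h3 : 0 ≤ ∫ X, (|f X| - c) ^ 2 ∂ν := integral_nonneg fun X => sq_nonneg _
  have h4 : ∫ X, (|f X| - c) ^ 2 ∂ν = ∫ X, f X ^ 2 ∂ν - 2 * c * c + c ^ 2 := by
    have h5 (X : Ω) : (|f X| - c) ^ 2 = f X ^ 2 - 2 * c * |f X| + c ^ 2 := by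
      rw [← sq_abs (f X)]; ring
    simp only [h5]
    rw [integral_sub_const_mul_add h2 h1, ← hc]
  nlinarith

lemma IsGibbs.integral_condPlus_sub_sq {μ : PMF ℕ+} {ν : Measure (ℤ → ℤˣ)} (h : IsGibbs μ ν)
    (y z : ℤ) : ∫ X, (condPlus μ y z X - plusProb ν {z}) ^ 2 ∂ν =
      ∫ k, plusProb ν {z, anc y k z} ∂jumpLaw μ - plusProb ν {z} ^ 2 := by
  have := h.isProbabilityMeasure
  set p := plusProb ν {z}
  have h1 : Integrable (condPlus μ y z) ν :=
    integrable_of_abs_le (measurable_condPlus μ y z) (abs_condPlus_le μ y z)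
  have h2 : Integrable (fun X => condPlus μ y z X * condPlus μ y z X) ν := by
    refine integrable_of_abs_le ((measurable_condPlus μ y z).mul (measurable_condPlus μ y z))
      (C := 1) fun X => ?_
    rw [abs_mul]
    exact mul_le_one₀ (abs_condPlus_le ..) (abs_nonneg _) (abs_condPlus_le ..)
  have h3 (X : ℤ → ℤˣ) : (condPlus μ y z X - p) ^ 2 =
      condPlus μ y z X * condPlus μ y z X - 2 * p * condPlus μ y z X + p ^ 2 := by ring
  simp only [h3]
  rw [integral_sub_const_mul_add h2 h1, h.integral_condPlus,
    h.integral_condPlus_mul_condPlus_of_le le_rfl]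
  ring

/-- The second moment of `condPlus μ y z` is the probability that `z` and an independently sampled
ancestor of `z` below `y` both carry `1`. Its convergence to `p ^ 2` makes the variance vanish. -/
lemma IsGibbs.pastLimit_of_tendsto {μ : PMF ℕ+} {ν : Measure (ℤ → ℤˣ)} (h : IsGibbs μ ν) {p : ℝ}
    (hp : ∀ z, plusProb ν {z} = p)
    (hlim : ∀ z, Tendsto (fun y => ∫ k, plusProb ν {z, anc y k z} ∂jumpLaw μ) atBot (𝓝 (p ^ 2))) :
    PastLimit μ ν p := by
  intro z
  have := h.isProbabilityMeasure
  have h1 : Tendsto (fun y => √(∫ X, (condPlus μ y z X - p) ^ 2 ∂ν)) atBot (𝓝 0) := by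
    have h2 := ((hlim z).sub_const (p ^ 2)).sqrt
    rw [sub_self, Real.sqrt_zero] at h2
    refine h2.congr fun y => ?_
    rw [← hp z, h.integral_condPlus_sub_sq]
  refine squeeze_zero (fun y => integral_nonneg fun X => abs_nonneg _) (fun y => ?_) h1
  refine integral_abs_le_sqrt ((measurable_condPlus μ y z).sub_const p) (C := 1 + |p|) fun X => ?_
  exact (abs_sub _ _).trans (add_le_add_left (abs_condPlus_le ..) _)

lemma plusProb_lambdaLaw_singleton (μ : PMF ℕ+) (p : unitInterval) (z : ℤ) :
    plusProb (lambdaLaw μ p) {z} = p := by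
  simp [plusProb_lambdaLaw, numComp]

lemma plusProb_lambdaLaw_pair_le (μ : PMF ℕ+) (p : unitInterval) (z w : ℤ) :
    plusProb (lambdaLaw μ p) {z, w} ≤ p ^ 2 + (meetProb μ z w).toReal := by
  have hm : Measurable fun k => (p : ℝ) ^ numComp k {z, w} :=
    (Measurable.of_discrete (f := fun n : ℕ => (p : ℝ) ^ n)).comp (measurable_numComp _)
  have hi : Integrable ({k | Meet k z w}.indicator (1 : (ℤ → ℕ+) → ℝ)) (jumpLaw μ) :=
    (integrable_const (1 : ℝ)).indicator (measurableSet_meet z w)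
  have h1 : (p : ℝ) ^ 2 + (meetProb μ z w).toReal =
      ∫ k, ((p : ℝ) ^ 2 + {k | Meet k z w}.indicator (1 : (ℤ → ℕ+) → ℝ) k) ∂jumpLaw μ := by
    rw [integral_add (integrable_const _) hi, integral_indicator_one (measurableSet_meet z w)]
    simp [meetProb, measureReal_def]
  rw [plusProb_lambdaLaw, h1]
  refine integral_mono (integrable_of_abs_le hm (C := 1) fun k =>
    abs_le_one_of_mem (pow_nonneg p.2.1 _) (pow_le_one₀ p.2.1 p.2.2))
    ((integrable_const _).add hi) fun k => ?_
  by_cases hk : Meet k z w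
  · simp only [Set.indicator_of_mem (show k ∈ {k | Meet k z w} from hk), Pi.one_apply]
    have h2 : (p : ℝ) ^ numComp k {z, w} ≤ 1 := pow_le_one₀ p.2.1 p.2.2
    have h3 := sq_nonneg (p : ℝ)
    linarith
  · have h2 : numComp k {z, w} = 2 := by
      classical
      rw [numComp, Finset.image_insert, Finset.image_singleton, Finset.card_pair]
      exact fun h => hk (component_eq_iff.mp h)
    simp only [Set.indicator_of_notMem (show k ∉ {k | Meet k z w} from hk), h2]
    simp

/-- The ancestor below a low level is far from `z`, hence unlikely to share its component. This
bounds the second moment above; the lower bound is nonnegativity of the variance. -/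
lemma pastLimit_lambdaLaw (μ : PMF ℕ+)
    (hgcd : Nat.setGcd ((fun n : ℕ+ => (n : ℕ)) '' μ.support) = 1)
    (hinf : ∀ᵐ k ∂jumpLaw μ, Infinite (jumpGraph k).ConnectedComponent) (p : unitInterval) :
    PastLimit μ (lambdaLaw μ p) p := by
  have hG := isGibbs_lambdaLaw μ p
  refine hG.pastLimit_of_tendsto (plusProb_lambdaLaw_singleton μ p) fun z => ?_
  have hint (y : ℤ) : Integrable (fun k => plusProb (lambdaLaw μ p) {z, anc y k z}) (jumpLaw μ) :=
    integrable_of_abs_le ((Measurable.of_discrete (f := fun v : ℤ =>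
      plusProb (lambdaLaw μ p) {z, v})).comp (measurable_anc y z)) fun k => abs_plusProb_le _ _
  have hmeet : Tendsto (fun w => (meetProb μ z w).toReal) atBot (𝓝 0) :=
    (ENNReal.tendsto_toReal ENNReal.zero_ne_top).comp (tendsto_meetProb μ hgcd hinf z)
  rw [Metric.tendsto_nhds]
  intro ε hε
  obtain ⟨w₀, hw₀⟩ := eventually_atBot.mp (hmeet.eventually_lt_const (half_pos hε))
  filter_upwards [eventually_le_atBot w₀] with y hy
  have hlow : 0 ≤ ∫ X, (condPlus μ y z X - plusProb (lambdaLaw μ p) {z}) ^ 2 ∂lambdaLaw μ p :=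
    integral_nonneg fun X => sq_nonneg _
  rw [hG.integral_condPlus_sub_sq, plusProb_lambdaLaw_singleton] at hlow
  have hup : ∫ k, plusProb (lambdaLaw μ p) {z, anc y k z} ∂jumpLaw μ ≤ p ^ 2 + ε / 2 := by
    have h1 := integral_mono (hint y) (integrable_const ((p : ℝ) ^ 2 + ε / 2)) fun k =>
      (plusProb_lambdaLaw_pair_le μ p z (anc y k z)).trans
        (add_le_add_right (hw₀ _ ((anc_lt y k z).le.trans hy)).le _)
    simpa using h1
  rw [Real.dist_eq, abs_lt]
  constructor <;> linarith

/-- Since `a • ν' ≤ ν`, convergence in `L¹` for `ν` passes to `ν'` at the cost of a factor `a⁻¹`. -/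
lemma PastLimit.of_convex {μ : PMF ℕ+} {ν ν' ν'' : Measure (ℤ → ℤˣ)} [IsFiniteMeasure ν] {p : ℝ}
    (hlim : PastLimit μ ν p) {a b : ℝ≥0} (ha : 0 < a) (hν : a • ν' + b • ν'' = ν) :
    PastLimit μ ν' p := by
  intro z
  have h1 := (hlim z).const_mul ((a : ℝ)⁻¹)
  rw [mul_zero] at h1
  refine squeeze_zero (fun y => integral_nonneg fun X => abs_nonneg _) (fun y => ?_) h1
  have hi : Integrable (fun X => |condPlus μ y z X - p|) ν :=
    ((integrable_of_abs_le (measurable_condPlus μ y z) (abs_condPlus_le μ y z)).sub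
      (integrable_const p)).abs
  have h2 : ∫ X, |condPlus μ y z X - p| ∂(a • ν') ≤ ∫ X, |condPlus μ y z X - p| ∂ν :=
    integral_mono_measure (hν ▸ Measure.le_add_right le_rfl) (.of_forall fun X => abs_nonneg _) hi
  rw [integral_smul_nnreal_measure, NNReal.smul_def, smul_eq_mul] at h2
  rwa [inv_mul_eq_div, le_div_iff₀ (by exact_mod_cast ha), mul_comm]

lemma lambdaLaw_mem_extremalGibbs (μ : PMF ℕ+)
    (hgcd : Nat.setGcd ((fun n : ℕ+ => (n : ℕ)) '' μ.support) = 1)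
    (hinf : ∀ᵐ k ∂jumpLaw μ, Infinite (jumpGraph k).ConnectedComponent) (p : unitInterval) :
    lambdaLaw μ p ∈ extremalGibbs μ := by
  refine ⟨isGibbs_lambdaLaw μ p, fun ν' hν' ν'' _ ⟨a, b, ha, _, _, hab⟩ => ?_⟩
  have hlim := pastLimit_lambdaLaw μ hgcd hinf p
  exact IsGibbs.eq_of_pastLimit hν' (isGibbs_lambdaLaw μ p) p.2.1 p.2.2
    (hlim.of_convex ha hab) hlim

/-! ### Extremal Gibbs measures -/

lemma prod_ind_anc (x : ℤ) (k : ℤ → ℕ+) (X : ℤ → ℤˣ) (S : Finset ℤ) :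
    ∏ z ∈ S, ind X (anc x k z) = ∏ z ∈ S.image (anc x k), ind X z := by
  have h : ∏ z ∈ S, ind X (anc x k z) = ∏ z ∈ S, ind (pull x k X) z := rfl
  rw [h, prod_ind, prod_ind]
  by_cases hX : pull x k X ∈ allOne S
  · rw [Set.indicator_of_mem hX, Set.indicator_of_mem (pull_mem_allOne.mp hX)]; rfl
  · rw [Set.indicator_of_notMem hX, Set.indicator_of_notMem fun h => hX (pull_mem_allOne.mpr h)]

/-- The conditional probability, given the spins below `x`, that all spins in `S` are `1`. -/
noncomputable def condAllOne (μ : PMF ℕ+) (x : ℤ) (S : Finset ℤ) (X : ℤ → ℤˣ) : ℝ :=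
  ∫ k, ∏ z ∈ S, ind X (anc x k z) ∂jumpLaw μ

lemma measurable_prod_ind_anc (x : ℤ) (S : Finset ℤ) :
    Measurable fun q : (ℤ → ℤˣ) × (ℤ → ℕ+) => ∏ z ∈ S, ind q.1 (anc x q.2 z) :=
  Finset.measurable_prod _ fun z _ => measurable_ind_anc x z

lemma measurable_condAllOne (μ : PMF ℕ+) (x : ℤ) (S : Finset ℤ) :
    Measurable (condAllOne μ x S) :=
  (measurable_prod_ind_anc x S).stronglyMeasurable.integral_prod_right'.measurable

lemma abs_condAllOne_le (μ : PMF ℕ+) (x : ℤ) (S : Finset ℤ) (X : ℤ → ℤˣ) :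
    |condAllOne μ x S X| ≤ 1 := by
  have h := norm_integral_le_of_norm_le_const (μ := jumpLaw μ) (C := 1)
    (f := fun k => ∏ z ∈ S, ind X (anc x k z))
    (.of_forall fun k => by rw [prod_ind_anc]; exact abs_prod_ind_le _ X)
  simpa [condAllOne] using h

/-! ### Tilted measures and limits of conditional probabilities -/

/-- The measure with density `w` with respect to `ν`. -/
noncomputable def tilt (ν : Measure (ℤ → ℤˣ)) (w : (ℤ → ℤˣ) → ℝ) : Measure (ℤ → ℤˣ) :=
  ν.withDensity fun X => ENNReal.ofReal (w X)

lemma integral_tilt (ν : Measure (ℤ → ℤˣ)) {w : (ℤ → ℤˣ) → ℝ} (hw : Measurable w)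
    (h0 : ∀ X, 0 ≤ w X) (f : (ℤ → ℤˣ) → ℝ) : ∫ X, f X ∂tilt ν w = ∫ X, w X * f X ∂ν := by
  rw [tilt, integral_withDensity_eq_integral_toReal_smul hw.ennreal_ofReal
    (.of_forall fun X => ENNReal.ofReal_lt_top)]
  simp only [ENNReal.toReal_ofReal (h0 _), smul_eq_mul]

lemma isProbabilityMeasure_tilt (ν : Measure (ℤ → ℤˣ)) [IsProbabilityMeasure ν]
    {w : (ℤ → ℤˣ) → ℝ} (hw : Measurable w) (h0 : ∀ X, 0 ≤ w X) {C : ℝ} (hC : ∀ X, w X ≤ C)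
    (h1 : ∫ X, w X ∂ν = 1) : IsProbabilityMeasure (tilt ν w) := by
  refine ⟨?_⟩
  rw [tilt, withDensity_apply _ .univ, Measure.restrict_univ,
    ← ofReal_integral_eq_lintegral_ofReal (integrable_of_abs_le hw (C := C) fun X => by
      rw [abs_of_nonneg (h0 X)]; exact hC X) (.of_forall h0), h1, ENNReal.ofReal_one]

lemma plusProb_tilt (ν : Measure (ℤ → ℤˣ)) {w : (ℤ → ℤˣ) → ℝ} (hw : Measurable w)
    (h0 : ∀ X, 0 ≤ w X) (S : Finset ℤ) :
    plusProb (tilt ν w) S = ∫ X, w X * ∏ z ∈ S, ind X z ∂ν := by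
  rw [plusProb_eq_integral, integral_tilt ν hw h0]

/-- The condition `hcond` plays the role of measurability of `w` with respect to the remote past:
weighting by `w` must not disturb the prescribed conditional probabilities. -/
lemma isGibbs_tilt (μ : PMF ℕ+) {ν : Measure (ℤ → ℤˣ)} [IsProbabilityMeasure ν]
    {w : (ℤ → ℤˣ) → ℝ} (hw : Measurable w) (h0 : ∀ X, 0 ≤ w X) {C : ℝ} (hC : ∀ X, w X ≤ C)
    (h1 : ∫ X, w X ∂ν = 1)
    (hcond : ∀ x S, ∫ X, w X * ∏ z ∈ S, ind X z ∂ν = ∫ X, w X * condAllOne μ x S X ∂ν) :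
    IsGibbs μ (tilt ν w) := by
  have := isProbabilityMeasure_tilt ν hw h0 hC h1
  refine isGibbs_of_plusProb μ _ fun x S => ?_
  simp only [plusProb_tilt ν hw h0]
  rw [hcond x S]
  simp only [condAllOne, ← integral_const_mul]
  rw [integral_integral_swap]
  · simp only [prod_ind_anc]
  · refine integrable_of_abs_le ((hw.comp measurable_fst).mul (measurable_prod_ind_anc x S))
      (C := C) fun q => ?_
    simp only [Function.uncurry]
    rw [abs_mul, abs_of_nonneg (h0 q.1), prod_ind_anc]
    exact (mul_le_of_le_one_right (h0 q.1) (abs_prod_ind_le _ _)).trans (hC q.1)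

/-- The second moment of `condPlus μ y z` under a Gibbs measure. -/
noncomputable def pastCorr (μ : PMF ℕ+) (ν : Measure (ℤ → ℤˣ)) (z y : ℤ) : ℝ :=
  ∫ k, plusProb ν {z, anc y k z} ∂jumpLaw μ

/-- Orthogonality of reverse martingale increments: the cross term equals the second moment at the
lower level `y`. -/
lemma IsGibbs.integral_sub_sq {μ : PMF ℕ+} {ν : Measure (ℤ → ℤˣ)} (h : IsGibbs μ ν) {x y : ℤ}
    (hy : y ≤ x) (z : ℤ) : ∫ X, (condPlus μ x z X - condPlus μ y z X) ^ 2 ∂ν =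
      pastCorr μ ν z x - pastCorr μ ν z y := by
  have := h.isProbabilityMeasure
  have hint (a b : ℤ) : Integrable (fun X => condPlus μ a z X * condPlus μ b z X) ν := by
    refine integrable_of_abs_le ((measurable_condPlus μ a z).mul (measurable_condPlus μ b z))
      (C := 1) fun X => ?_
    rw [abs_mul]
    exact mul_le_one₀ (abs_condPlus_le ..) (abs_nonneg _) (abs_condPlus_le ..)
  have h3 (X : ℤ → ℤˣ) : (condPlus μ x z X - condPlus μ y z X) ^ 2 =
      condPlus μ x z X * condPlus μ x z X - 2 * (condPlus μ x z X * condPlus μ y z X) +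
        condPlus μ y z X * condPlus μ y z X := by ring
  have h4 : Integrable (fun X => condPlus μ x z X * condPlus μ x z X -
      2 * (condPlus μ x z X * condPlus μ y z X)) ν := (hint x x).sub ((hint x y).const_mul 2)
  simp only [h3]
  rw [integral_add h4 (hint y y), integral_sub (hint x x) ((hint x y).const_mul 2),
    integral_const_mul, h.integral_condPlus_mul_condPlus_of_le hy,
    h.integral_condPlus_mul_condPlus_of_le le_rfl, h.integral_condPlus_mul_condPlus_of_le le_rfl]
  simp only [pastCorr]
  ring

lemma IsGibbs.monotone_pastCorr {μ : PMF ℕ+} {ν : Measure (ℤ → ℤˣ)} (h : IsGibbs μ ν) (z : ℤ) :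
    Monotone (pastCorr μ ν z) := fun y x hy => by
  rw [← sub_nonneg, ← h.integral_sub_sq hy z]
  exact integral_nonneg fun X => sq_nonneg _

lemma bddBelow_pastCorr (μ : PMF ℕ+) (ν : Measure (ℤ → ℤˣ)) (z : ℤ) :
    BddBelow (Set.range (pastCorr μ ν z)) :=
  ⟨0, by rintro _ ⟨y, rfl⟩; exact integral_nonneg fun k => plusProb_nonneg _ _⟩

lemma IsGibbs.tendsto_pastCorr {μ : PMF ℕ+} {ν : Measure (ℤ → ℤˣ)} (h : IsGibbs μ ν) (z : ℤ) :
    Tendsto (pastCorr μ ν z) atBot (𝓝 (⨅ y, pastCorr μ ν z y)) :=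
  tendsto_atBot_ciInf (h.monotone_pastCorr z) (bddBelow_pastCorr μ ν z)

lemma tendsto_neg_natCast_atBot : Tendsto (fun n : ℕ => (-n : ℤ)) atTop atBot :=
  tendsto_neg_atTop_atBot.comp tendsto_natCast_atTop_atTop

/-- The conditional probabilities given the past converge, along a sequence of levels. -/
lemma IsGibbs.exists_condPlus_limit {μ : PMF ℕ+} {ν : Measure (ℤ → ℤˣ)} (h : IsGibbs μ ν)
    (z : ℤ) : ∃ g : (ℤ → ℤˣ) → ℝ, Measurable g ∧ (∀ X, 0 ≤ g X) ∧ (∀ X, g X ≤ 1) ∧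
      ∃ y : ℕ → ℤ, Tendsto y atTop atBot ∧
        ∀ᵐ X ∂ν, Tendsto (fun n => condPlus μ (y n) z X) atTop (𝓝 (g X)) := by
  have := h.isProbabilityMeasure
  have hint (y : ℤ) : Integrable (condPlus μ y z) ν :=
    integrable_of_abs_le (measurable_condPlus μ y z) (abs_condPlus_le μ y z)
  set L := ⨅ y, pastCorr μ ν z y
  -- The `L¹` distance is at most the `L²` distance, whose square is the drop of `pastCorr` between
  -- the two levels, so at most its excess over the infimum.
  have hdist (n m : ℕ) (hnm : n ≤ m) : dist ((hint (-n)).toL1 _) ((hint (-m)).toL1 _) ≤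
      √(pastCorr μ ν z (-n) - L) := by
    rw [dist_eq_norm, ← Integrable.toL1_sub, L1.norm_of_fun_eq_integral_norm]
    refine (integral_abs_le_sqrt ((measurable_condPlus μ _ z).sub (measurable_condPlus μ _ z))
      (C := 2) fun X => ?_).trans (Real.sqrt_le_sqrt ?_)
    · have h1 := abs_condPlus_le μ (-n) z X
      have h2 := abs_condPlus_le μ (-m) z X
      exact (abs_sub _ _).trans (by linarith)
    · simp only [Pi.sub_apply]
      rw [h.integral_sub_sq (by omega) z]
      exact sub_le_sub_left (ciInf_le (bddBelow_pastCorr μ ν z) _) _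
  have hcauchy : CauchySeq fun n : ℕ => (hint (-n)).toL1 _ := by
    refine cauchySeq_of_le_tendsto_0 (fun n : ℕ => √(pastCorr μ ν z (-n) - L))
      (fun n m N hn hm => ?_) ?_
    · have hmono (n : ℕ) (hn : N ≤ n) :
          √(pastCorr μ ν z (-n) - L) ≤ √(pastCorr μ ν z (-N) - L) :=
        Real.sqrt_le_sqrt (sub_le_sub_right (h.monotone_pastCorr z (by omega)) _)
      rcases le_total n m with hnm | hnm
      · exact (hdist n m hnm).trans (hmono n hn)
      · rw [dist_comm]
        exact (hdist m n hnm).trans (hmono m hm)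
    · have h1 := (((h.tendsto_pastCorr z).comp tendsto_neg_natCast_atBot).sub_const L).sqrt
      simpa [L] using h1
  obtain ⟨f, hf⟩ := cauchySeq_tendsto_of_complete hcauchy
  obtain ⟨ns, hns, hae⟩ := (tendstoInMeasure_of_tendsto_Lp hf).exists_seq_tendsto_ae
  have hcoe : ∀ᵐ X ∂ν, ∀ n : ℕ, (hint (-n)).toL1 _ X = condPlus μ (-n) z X := by
    rw [ae_all_iff]
    exact fun n => Integrable.coeFn_toL1 (hint (-n))
  -- Clipping to `[0, 1]` makes the bounds hold everywhere; almost everywhere it changes nothing.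
  refine ⟨fun X => max 0 (min 1 (f X)), ?_, fun X => le_max_left _ _,
    fun X => max_le zero_le_one (min_le_left _ _), fun n => -(ns n : ℤ),
    tendsto_neg_natCast_atBot.comp hns.tendsto_atTop, ?_⟩
  · exact measurable_const.max (measurable_const.min (Lp.stronglyMeasurable f).measurable)
  · filter_upwards [hae, hcoe] with X hX hc
    simp only [hc] at hX
    have h1 : 0 ≤ f X := ge_of_tendsto' hX fun n => condPlus_nonneg ..
    have h2 : f X ≤ 1 := le_of_tendsto' hX fun n => condPlus_le_one ..
    rwa [min_eq_right h2, max_eq_right h1]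

lemma condPlus_pull {x y : ℤ} (hy : y ≤ x) (μ : PMF ℕ+) (k : ℤ → ℕ+) (z : ℤ) (X : ℤ → ℤˣ) :
    condPlus μ y z (pull x k X) = condPlus μ y z X := by
  refine integral_congr_ae (.of_forall fun k' => ?_)
  simp only [ind, pull, anc_of_lt k ((anc_lt y k' z).trans_le hy)]

lemma IsGibbs.integral_prod_ind_mul_condPlus_eq {μ : PMF ℕ+} {ν : Measure (ℤ → ℤˣ)}
    (h : IsGibbs μ ν) {x y : ℤ} (hy : y ≤ x) (z : ℤ) (S : Finset ℤ) :
    ∫ X, (∏ v ∈ S, ind X v) * condPlus μ y z X ∂ν =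
      ∫ X, condAllOne μ x S X * condPlus μ y z X ∂ν := by
  rw [h.integral_eq x (f := fun X => (∏ v ∈ S, ind X v) * condPlus μ y z X)
    ((measurable_prod_ind S).mul (measurable_condPlus μ y z)) (C := 1) fun X => ?_]
  · refine integral_congr_ae (.of_forall fun X => ?_)
    simp only [condPlus_pull hy]
    rw [integral_mul_const]
    rfl
  · rw [abs_mul]
    exact mul_le_one₀ (abs_prod_ind_le ..) (abs_nonneg _) (abs_condPlus_le ..)

lemma plusProb_convex {ν' ν'' : Measure (ℤ → ℤˣ)} [IsFiniteMeasure ν'] [IsFiniteMeasure ν'']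
    (a b : ℝ≥0) (S : Finset ℤ) :
    plusProb (a • ν' + b • ν'') S = a * plusProb ν' S + b * plusProb ν'' S := by
  rw [plusProb, measureReal_add_apply, measureReal_nnreal_smul_apply,
    measureReal_nnreal_smul_apply]
  rfl

lemma isProbabilityMeasure_convex {ν' ν'' : Measure (ℤ → ℤˣ)} [IsProbabilityMeasure ν']
    [IsProbabilityMeasure ν''] {a b : ℝ≥0} (hab : a + b = 1) :
    IsProbabilityMeasure (a • ν' + b • ν'') := by
  refine ⟨?_⟩
  simp only [Measure.add_apply, Measure.smul_apply, measure_univ]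
  rw [ENNReal.smul_def, ENNReal.smul_def, smul_eq_mul, smul_eq_mul, mul_one, mul_one,
    ← ENNReal.coe_add, hab, ENNReal.coe_one]

/-- In an extremal Gibbs measure, the second moments of the conditional probabilities given the
past converge to the square of the mean. -/
lemma tendsto_pastCorr_of_extremal {μ : PMF ℕ+} {ν : Measure (ℤ → ℤˣ)}
    (hν : ν ∈ extremalGibbs μ) (z : ℤ) :
    Tendsto (pastCorr μ ν z) atBot (𝓝 (plusProb ν {z} ^ 2)) := by
  have h : IsGibbs μ ν := hν.1
  have := h.isProbabilityMeasure
  obtain ⟨g, hgm, hg0, hg1, y, hy, hlim⟩ := h.exists_condPlus_limit z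
  have hconv {f : (ℤ → ℤˣ) → ℝ} (hf : Measurable f) (hf1 : ∀ X, |f X| ≤ 1) :
      Tendsto (fun n => ∫ X, f X * condPlus μ (y n) z X ∂ν) atTop (𝓝 (∫ X, f X * g X ∂ν)) := by
    refine tendsto_integral_of_dominated_convergence (fun _ => 1)
      (fun n => (hf.mul (measurable_condPlus μ (y n) z)).aestronglyMeasurable)
      (integrable_const _) (fun n => .of_forall fun X => ?_) ?_
    · rw [norm_mul]
      exact mul_le_one₀ (hf1 X) (norm_nonneg _) (abs_condPlus_le ..)
    · filter_upwards [hlim] with X hX using hX.const_mul _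
  have hgi : Integrable g ν :=
    integrable_of_abs_le hgm (C := 1) fun X => abs_le_one_of_mem (hg0 X) (hg1 X)
  have hfi {f : (ℤ → ℤˣ) → ℝ} (hf : Measurable f) (hf1 : ∀ X, |f X| ≤ 1) :
      Integrable (fun X => f X * g X) ν := by
    refine integrable_of_abs_le (hf.mul hgm) (C := 1) fun X => ?_
    rw [abs_mul]
    exact mul_le_one₀ (hf1 X) (abs_nonneg _) (abs_le_one_of_mem (hg0 X) (hg1 X))
  have hmean : ∫ X, g X ∂ν = plusProb ν {z} := by
    have h1 := hconv (f := fun _ => 1) measurable_const (by simp)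
    simp only [one_mul, h.integral_condPlus] at h1
    exact tendsto_nhds_unique h1 tendsto_const_nhds
  -- For levels below `x` this identity is the Gibbs property, since `condPlus` at such a level
  -- ignores the spins from `x` on. It then passes to the limit `g`.
  have hcond (x : ℤ) (S : Finset ℤ) :
      ∫ X, (∏ v ∈ S, ind X v) * g X ∂ν = ∫ X, condAllOne μ x S X * g X ∂ν := by
    refine tendsto_nhds_unique (hconv (measurable_prod_ind S) (abs_prod_ind_le S))
      ((hconv (measurable_condAllOne μ x S) (abs_condAllOne_le μ x S)).congr' ?_)
    filter_upwards [hy.eventually_le_atBot x] with n hn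
    exact (h.integral_prod_ind_mul_condPlus_eq hn z S).symm
  have hbase (x : ℤ) (S : Finset ℤ) : ∫ X, ∏ v ∈ S, ind X v ∂ν = ∫ X, condAllOne μ x S X ∂ν :=
    h.integral_eq x (measurable_prod_ind S) (abs_prod_ind_le S)
  set p := plusProb ν {z} with hp
  have hp0 : 0 ≤ p := plusProb_nonneg _ _
  have hp1 : p ≤ 1 := plusProb_le_one _ _
  -- affine functions of `g` are densities of Gibbs measures
  have hexp {f : (ℤ → ℤˣ) → ℝ} (hf : Measurable f) (hf1 : ∀ X, |f X| ≤ 1) (a b : ℝ) :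
      ∫ X, (a + b * g X) * f X ∂ν = a * ∫ X, f X ∂ν + b * ∫ X, f X * g X ∂ν := by
    have h1 (X : ℤ → ℤˣ) : (a + b * g X) * f X = a * f X + b * (f X * g X) := by ring
    simp only [h1]
    rw [integral_add ((integrable_of_abs_le hf hf1).const_mul a) ((hfi hf hf1).const_mul b),
      integral_const_mul, integral_const_mul]
  have hgibbs (a b : ℝ) (h0 : ∀ X, 0 ≤ a + b * g X) (h1 : a + b * p = 1) :
      IsGibbs μ (tilt ν fun X => a + b * g X) := by
    refine isGibbs_tilt μ (measurable_const.add (hgm.const_mul b)) h0 (C := |a| + |b|)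
      (fun X => ?_) ?_ fun x S => ?_
    · refine add_le_add (le_abs_self a) ((le_abs_self _).trans ?_)
      rw [abs_mul]
      exact mul_le_of_le_one_right (abs_nonneg _) (abs_le_one_of_mem (hg0 X) (hg1 X))
    · rw [integral_add (integrable_const _) (hgi.const_mul b), integral_const_mul, hmean]
      simpa using h1
    · rw [hexp (measurable_prod_ind S) (abs_prod_ind_le S), hexp (measurable_condAllOne μ x S)
        (abs_condAllOne_le μ x S), hbase x S, hcond x S]
  -- The densities are `(1 + g) / (1 + p)` and `(2 - g) / (2 - p)`, mixed with weights `(1 + p) / 3`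
  -- and `(2 - p) / 3`. The shifts keep all denominators and weights positive even when `p` is `0`
  -- or `1`.
  have hq : 0 < 1 + p := by linarith
  have hr : 0 < 2 - p := by linarith
  have h0' (X : ℤ → ℤˣ) : 0 ≤ (1 + p)⁻¹ + (1 + p)⁻¹ * g X :=
    add_nonneg (by positivity) (mul_nonneg (by positivity) (hg0 X))
  have h0'' (X : ℤ → ℤˣ) : 0 ≤ 2 * (2 - p)⁻¹ + -(2 - p)⁻¹ * g X := by
    have h1 : 0 ≤ (2 - p)⁻¹ := by positivity
    nlinarith [hg1 X]
  have hG' := hgibbs (1 + p)⁻¹ (1 + p)⁻¹ h0' (by field_simp)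
  have hG'' := hgibbs (2 * (2 - p)⁻¹) (-(2 - p)⁻¹) h0'' (by field_simp; ring)
  set ν' := tilt ν fun X => (1 + p)⁻¹ + (1 + p)⁻¹ * g X with hν'
  set ν'' := tilt ν fun X => 2 * (2 - p)⁻¹ + -(2 - p)⁻¹ * g X with hν''
  have hP {a b : ℝ} (h0 : ∀ X, 0 ≤ a + b * g X) (S : Finset ℤ) :
      plusProb (tilt ν fun X => a + b * g X) S =
        a * plusProb ν S + b * ∫ X, (∏ v ∈ S, ind X v) * g X ∂ν := by
    have hm : Measurable fun X => a + b * g X := measurable_const.add (hgm.const_mul b)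
    rw [plusProb_tilt ν hm h0, hexp (measurable_prod_ind S) (abs_prod_ind_le S),
      plusProb_eq_integral]
  have hP' := hP h0'
  have hP'' := hP h0''
  rw [← hν'] at hP'
  rw [← hν''] at hP''
  have hprob' := hG'.isProbabilityMeasure
  have hprob'' := hG''.isProbabilityMeasure
  let a : ℝ≥0 := ⟨(1 + p) / 3, by positivity⟩
  let b : ℝ≥0 := ⟨(2 - p) / 3, by positivity⟩
  have hab : a + b = 1 := by
    apply NNReal.eq
    change (1 + p) / 3 + (2 - p) / 3 = 1
    ring
  have hconvex : a • ν' + b • ν'' = ν := by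
    have hprob := isProbabilityMeasure_convex (ν' := ν') (ν'' := ν'') hab
    refine ext_of_plusProb fun S => ?_
    have h1 : plusProb (a • ν' + b • ν'') S =
        (1 + p) / 3 * plusProb ν' S + (2 - p) / 3 * plusProb ν'' S := plusProb_convex a b S
    rw [h1, hP', hP'']
    field_simp
    ring
  have heq : ν' = ν := hν.2 hG' hG'' ⟨a, b, by change 0 < (1 + p) / 3; positivity,
    by change 0 < (2 - p) / 3; positivity, hab, hconvex⟩
  -- Equality of `ν'` and `ν` on the event of a `1` at `z` reads `(p + ∫ ind * g) / (1 + p) = p`.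
  have hval : ∫ X, ind X z * g X ∂ν = p ^ 2 := by
    have h1 := hP' {z}
    rw [heq] at h1
    simp only [Finset.prod_singleton, ← hp] at h1
    field_simp at h1
    linarith
  have hlim' := hconv (measurable_ind z) fun X => abs_le_one_of_mem (ind_nonneg X z) (ind_le_one X z)
  rw [hval] at hlim'
  have hcorr (n : ℕ) : ∫ X, ind X z * condPlus μ (y n) z X ∂ν = pastCorr μ ν z (y n) := by
    have h1 := integral_prod_ind_mul_condPlus μ ν (y n) z {z}
    simp only [Finset.prod_singleton, Finset.pair_comm (anc (y n) _ z) z] at h1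
    exact h1
  simp only [hcorr] at hlim'
  -- The full limit exists by monotonicity, so the subsequence of levels `y n` identifies it.
  have h1 := h.tendsto_pastCorr z
  rwa [tendsto_nhds_unique (h1.comp hy) hlim'] at h1

/-- The Gibbs property at level `z` itself replaces `z` by its parent, so the one-point function is
harmonic. -/
lemma IsGibbs.plusProb_singleton_eq {μ : PMF ℕ+} {ν : Measure (ℤ → ℤˣ)} (h : IsGibbs μ ν)
    (hgcd : Nat.setGcd ((fun n : ℕ+ => (n : ℕ)) '' μ.support) = 1) (z w : ℤ) :
    plusProb ν {z} = plusProb ν {w} := by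
  have := h.isProbabilityMeasure
  refine harmonic_const μ hgcd (f := fun z => plusProb ν {z}) (C := 1)
    (fun z => abs_plusProb_le ν _) (fun z => ?_) z w
  rw [h.plusProb_eq z {z}, ← jumpLaw_map_eval μ z, integral_map
    (measurable_pi_apply z).aemeasurable Measurable.of_discrete.aestronglyMeasurable]
  simp only [Finset.image_singleton, anc_self]

lemma extremalGibbs_of_infinite (μ : PMF ℕ+)
    (hgcd : Nat.setGcd ((fun n : ℕ+ => (n : ℕ)) '' μ.support) = 1)
    (hinf : ∀ᵐ k ∂jumpLaw μ, Infinite (jumpGraph k).ConnectedComponent) :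
    extremalGibbs μ = Set.range fun p : unitInterval => lambdaLaw μ p := by
  ext ν
  constructor
  · intro hν
    have h : IsGibbs μ ν := hν.1
    have := h.isProbabilityMeasure
    let p : unitInterval := ⟨plusProb ν {0}, plusProb_nonneg _ _, plusProb_le_one _ _⟩
    have hp (z : ℤ) : plusProb ν {z} = p := h.plusProb_singleton_eq hgcd z 0
    refine ⟨p, (isGibbs_lambdaLaw μ p).eq_of_pastLimit h p.2.1 p.2.2
      (pastLimit_lambdaLaw μ hgcd hinf p) (h.pastLimit_of_tendsto hp fun z => ?_)⟩
    rw [← hp z]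
    exact tendsto_pastCorr_of_extremal hν z
  · rintro ⟨p, rfl⟩
    exact lambdaLaw_mem_extremalGibbs μ hgcd hinf p

/-! ### The connected case -/

/-- Below a low enough level all vertices of `S` share one ancestor, and one-point probabilities do
not depend on the vertex. -/
lemma IsGibbs.plusProb_eq_of_connected {μ : PMF ℕ+} {ν : Measure (ℤ → ℤˣ)} (h : IsGibbs μ ν)
    (hgcd : Nat.setGcd ((fun n : ℕ+ => (n : ℕ)) '' μ.support) = 1)
    (hconn : ∀ᵐ k ∂jumpLaw μ, (jumpGraph k).Connected) {S : Finset ℤ} (hS : S.Nonempty) :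
    plusProb ν S = plusProb ν {0} := by
  have := h.isProbabilityMeasure
  have hlim : Tendsto (fun x => ∫ k, plusProb ν (S.image (anc x k)) ∂jumpLaw μ) atBot
      (𝓝 (∫ _, plusProb ν {0} ∂jumpLaw μ)) := by
    refine tendsto_integral_filter_of_dominated_convergence (fun _ => 1)
      (.of_forall fun x => (measurable_image_anc x S (plusProb ν)).aestronglyMeasurable)
      (.of_forall fun x => .of_forall fun k => abs_plusProb_le ν _) (integrable_const _) ?_
    filter_upwards [hconn] with k hk
    obtain ⟨a, ha⟩ := hS
    have h1 : ∀ᶠ x in atBot, ∀ b ∈ S, anc x k a = anc x k b := by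
      rw [Finset.eventually_all]
      exact fun b _ => (reachable_iff_meet.mp (hk.preconnected a b)).eventually
    refine tendsto_const_nhds.congr' ?_
    filter_upwards [h1] with x hx
    have h2 : S.image (anc x k) = {anc x k a} := by
      ext v
      simp only [Finset.mem_image, Finset.mem_singleton]
      exact ⟨fun ⟨b, hb, hv⟩ => by rw [← hv, hx b hb], fun hv => ⟨a, ha, hv.symm⟩⟩
    rw [h2]
    exact h.plusProb_singleton_eq hgcd _ _
  have h2 := tendsto_nhds_unique hlim (tendsto_const_nhds.congr fun x => h.plusProb_eq x S)
  simpa using h2.symm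

lemma plusProb_dirac_one (S : Finset ℤ) :
    plusProb (Measure.dirac fun _ : ℤ => (1 : ℤˣ)) S = 1 := by
  have h : (fun _ : ℤ => (1 : ℤˣ)) ∈ allOne S := fun _ _ => rfl
  rw [plusProb, measureReal_def, Measure.dirac_apply_of_mem h, ENNReal.toReal_one]

lemma plusProb_dirac_neg_one {S : Finset ℤ} (hS : S.Nonempty) :
    plusProb (Measure.dirac fun _ : ℤ => (-1 : ℤˣ)) S = 0 := by
  have h : (fun _ : ℤ => (-1 : ℤˣ)) ∉ allOne S := fun h => by
    obtain ⟨a, ha⟩ := hS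
    exact absurd (show (-1 : ℤˣ) = 1 from h a ha) (by decide)
  rw [plusProb, measureReal_def, Measure.dirac_apply' _ (measurableSet_allOne S),
    Set.indicator_of_notMem h, ENNReal.toReal_zero]

lemma plusProb_empty (ν : Measure (ℤ → ℤˣ)) [IsProbabilityMeasure ν] : plusProb ν ∅ = 1 := by
  simp [plusProb]

lemma isGibbs_dirac_one (μ : PMF ℕ+) : IsGibbs μ (Measure.dirac fun _ : ℤ => (1 : ℤˣ)) :=
  isGibbs_of_plusProb μ _ fun x S => by simp [plusProb_dirac_one]

lemma isGibbs_dirac_neg_one (μ : PMF ℕ+) : IsGibbs μ (Measure.dirac fun _ : ℤ => (-1 : ℤˣ)) :=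
  isGibbs_of_plusProb μ _ fun x S => by
    rcases S.eq_empty_or_nonempty with rfl | hS
    · simp [plusProb_empty]
    · simp [plusProb_dirac_neg_one, hS]

lemma extremalGibbs_of_connected (μ : PMF ℕ+)
    (hgcd : Nat.setGcd ((fun n : ℕ+ => (n : ℕ)) '' μ.support) = 1)
    (hconn : ∀ᵐ k ∂jumpLaw μ, (jumpGraph k).Connected) :
    extremalGibbs μ = {Measure.dirac (fun _ : ℤ => (1 : ℤˣ)),
      Measure.dirac (fun _ : ℤ => (-1 : ℤˣ))} := by
  have hext {ν ν' : Measure (ℤ → ℤˣ)} [IsProbabilityMeasure ν] [IsProbabilityMeasure ν']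
      (h : ∀ S : Finset ℤ, S.Nonempty → plusProb ν S = plusProb ν' S) : ν = ν' := by
    refine ext_of_plusProb fun S => ?_
    rcases S.eq_empty_or_nonempty with rfl | hS
    · rw [plusProb_empty, plusProb_empty]
    · exact h S hS
  have hone {ν : Measure (ℤ → ℤˣ)} (h : IsGibbs μ ν) (h1 : plusProb ν {0} = 1) :
      ν = Measure.dirac fun _ : ℤ => (1 : ℤˣ) := by
    have := h.isProbabilityMeasure
    exact hext fun S hS => by
      rw [h.plusProb_eq_of_connected hgcd hconn hS, h1, plusProb_dirac_one]
  have hneg {ν : Measure (ℤ → ℤˣ)} (h : IsGibbs μ ν) (h0 : plusProb ν {0} = 0) :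
      ν = Measure.dirac fun _ : ℤ => (-1 : ℤˣ) := by
    have := h.isProbabilityMeasure
    exact hext fun S hS => by
      rw [h.plusProb_eq_of_connected hgcd hconn hS, h0, plusProb_dirac_neg_one hS]
  ext ν
  simp only [Set.mem_insert_iff, Set.mem_singleton_iff]
  constructor
  · intro hν
    have h : IsGibbs μ ν := hν.1
    have := h.isProbabilityMeasure
    rcases (plusProb_nonneg ν {0}).eq_or_lt with h0 | h0
    · exact .inr (hneg h h0.symm)
    rcases (plusProb_le_one ν {0}).eq_or_lt with h1 | h1
    · exact .inl (hone h h1)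
    -- For `0 < p < 1`, `ν` is a proper mixture of the two point masses, and extremality equates it
    -- with the first one; no separate contradiction is needed.
    left
    let a : ℝ≥0 := ⟨plusProb ν {0}, h0.le⟩
    let b : ℝ≥0 := ⟨1 - plusProb ν {0}, by linarith⟩
    have hab : a + b = 1 := NNReal.eq (by change plusProb ν {0} + (1 - plusProb ν {0}) = 1; ring)
    refine (hν.2 (isGibbs_dirac_one μ) (isGibbs_dirac_neg_one μ)
      ⟨a, b, h0, by change 0 < 1 - plusProb ν {0}; linarith, hab, ?_⟩).symm
    have hprob := isProbabilityMeasure_convex (ν' := Measure.dirac fun _ : ℤ => (1 : ℤˣ))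
      (ν'' := Measure.dirac fun _ : ℤ => (-1 : ℤˣ)) hab
    refine hext fun S hS => ?_
    rw [plusProb_convex, plusProb_dirac_one, plusProb_dirac_neg_one hS,
      h.plusProb_eq_of_connected hgcd hconn hS, mul_one, mul_zero, add_zero]
    rfl
  · rintro (rfl | rfl)
    · refine ⟨isGibbs_dirac_one μ, fun ν' hν' ν'' hν'' ⟨a, b, ha, hb, hab, h⟩ => hone hν' ?_⟩
      have := hν'.isProbabilityMeasure
      have := hν''.isProbabilityMeasure
      have h1 := plusProb_convex (ν' := ν') (ν'' := ν'') a b {0}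
      rw [h, plusProb_dirac_one] at h1
      have h2 : (a : ℝ) + b = 1 := by exact_mod_cast hab
      have h3 : (0 : ℝ) < a := by exact_mod_cast ha
      nlinarith [plusProb_le_one ν' {0},
        mul_le_mul_of_nonneg_left (plusProb_le_one ν'' {0}) b.coe_nonneg]
    · refine ⟨isGibbs_dirac_neg_one μ, fun ν' hν' ν'' hν'' ⟨a, b, ha, hb, hab, h⟩ => hneg hν' ?_⟩
      have := hν'.isProbabilityMeasure
      have := hν''.isProbabilityMeasure
      have h1 := plusProb_convex (ν' := ν') (ν'' := ν'') a b {0}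
      rw [h, plusProb_dirac_neg_one (Finset.singleton_nonempty 0)] at h1
      have h3 : (0 : ℝ) < a := by exact_mod_cast ha
      have h4 := plusProb_nonneg ν' {0}
      have h5 := mul_nonneg b.coe_nonneg (plusProb_nonneg ν'' {0})
      by_contra hne
      have h6 := mul_pos h3 (lt_of_le_of_ne h4 (Ne.symm hne))
      linarith

end AncestralGibbs

theorem proposition1 (μ : PMF ℕ+)
    (hgcd : Nat.setGcd ((fun n : ℕ+ => (n : ℕ)) '' μ.support) = 1) :
    ((∀ᵐ k ∂AncestralGibbs.jumpLaw μ, (AncestralGibbs.jumpGraph k).Connected) →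
      AncestralGibbs.extremalGibbs μ =
        {Measure.dirac (fun _ : ℤ => (1 : ℤˣ)), Measure.dirac (fun _ : ℤ => (-1 : ℤˣ))}) ∧
    ((∀ᵐ k ∂AncestralGibbs.jumpLaw μ,
        Infinite (AncestralGibbs.jumpGraph k).ConnectedComponent) →
      AncestralGibbs.extremalGibbs μ =
        Set.range fun p : unitInterval => AncestralGibbs.lambdaLaw μ p) := by
  exact ⟨AncestralGibbs.extremalGibbs_of_connected μ hgcd,
    AncestralGibbs.extremalGibbs_of_infinite μ hgcd⟩
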